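/- Let $k,\ell,m$ be integers with $0\le k\le \ell<m$, and let $\alpha,\gamma\in\mathbb C$ satisfy $\operatorname{Re}\alpha>0$ and $\operatorname{Re}\gamma>-\min\left(\frac1m,\frac{\operatorname{Re}\alpha}{m-1}\right)$ (for $m=1$ the condition on $\gamma$ reads $\operatorname{Re}\gamma>-1$). Write $\Delta(\lambda)=\prod_{1\le i<j\le m}(\lambda_i-\lambda_j)$, let $(a)_n=a(a+1)\cdots(a+n-1)$ be the rising factorial, with $(a)_0=1$, and put $\mathbb R_+=(0,\infty)$. Then the integral on the left below converges absolutely, and for $\gamma\neq0$ $$\int_{\mathbb R_+^m}\Big(\prod_{i=1}^k\lambda_i\Big)\Big(\prod_{i=1}^\ell\lambda_i\Big)\,|\Delta(\lambda)|^{2\gamma}\prod_{j=1}^m\lambda_j^{\alpha-1}e^{-\lambda_j}\,d\lambda_j=\gamma^{k+\ell}\Big(\frac{1+\alpha}{\gamma}+2m-\ell-k\Big)_k\Big(\frac{\alpha}{\gamma}+m-\ell\Big)_\ell\;\prod_{j=0}^{m-1}\frac{\Gamma(1+\gamma+j\gamma)\,\Gamma(\alpha+j\gamma)}{\Gamma(1+\gamma)}.$$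 For $\gamma=0$ the same identity holds with the factor $\gamma^{k+\ell}\big(\frac{1+\alpha}{\gamma}+2m-\ell-k\big)_k\big(\frac{\alpha}{\gamma}+m-\ell\big)_\ell$ replaced by its limit $(1+\alpha)^k\alpha^\ell$ as $\gamma\to0$. -/

import Mathlib

noncomputable section

namespace SelbergExt

/-- The Vandermonde product of a real vector: the product of `x i - x j` over all `i < j`. -/
def vdm {m : ℕ} (x : Fin m → ℝ) : ℝ :=
  ∏ i : Fin m, ∏ j ∈ Finset.Ioi i, (x i - x j)

/-- The positive orthant of `ℝ^m`. -/
def posOrthant (m : ℕ) : Set (Fin m → ℝ) :=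
  {x | ∀ i, 0 < x i}

/-- The product of the first `n` coordinates (used for `n < m`; coordinates are numbered
from `0`). -/
def firstProd {m : ℕ} (n : ℕ) (x : Fin m → ℝ) : ℝ :=
  ∏ i : Fin m with i.val < n, x i

/-- The integrand: first `k` coordinates times first `l` coordinates times the density of the
exponential Selberg integral, with complex powers of non-negative real numbers. -/
def integrand {m : ℕ} (k l : ℕ) (α γ : ℂ) (x : Fin m → ℝ) : ℂ :=
  (firstProd k x : ℂ) * (firstProd l x : ℂ) * ((|vdm x| : ℝ) : ℂ) ^ (2 * γ) *
    ∏ j : Fin m, ((x j : ℂ) ^ (α - 1) * (Real.exp (-x j) : ℂ))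

/-- The rising factorial `a (a + 1) ⋯ (a + n - 1)`. -/
def rising (a : ℂ) (n : ℕ) : ℂ :=
  ∏ i ∈ Finset.range n, (a + i)

/-- The value of the exponential Selberg integral. -/
def selbergValue (m : ℕ) (α γ : ℂ) : ℂ :=
  ∏ j ∈ Finset.range m,
    (Complex.Gamma (1 + γ + j * γ) * Complex.Gamma (α + j * γ) / Complex.Gamma (1 + γ))

end SelbergExt

end

open MeasureTheory Set
open scoped ENNReal

noncomputable section

namespace SelbergExt

/-! Let `S_m(α, γ)` be the integral with `k = l = 0`. For real `α = a > 1` and `γ = g > 1/2` the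
identity follows from Aomoto's method. The integral of the `x_p`-derivative of the density vanishes.
Differentiating `|Δ|^(2g)` produces terms `2g / (x_p - x_q)` times the density, and swapping `x_p`
with `x_q` turns each of them into `0`, `1/2` or `1` times one and the same integral, depending on
how the exponents at `p` and `q` compare. This gives a linear factor for raising one exponent by one
(`multiInt_update_add_one`). Raising the first `l` exponents and then the first `k` again yields the
two rising factorials times `S_m` (`multiInt_shape`).

The same recursion evaluates `S_m`: raising all exponents gives `S_m(a+1, g) = ∏ (a + j g) · S_m(a,
g)`. By Hölder, `log S_m` is convex in `a`, so a Bohr–Mollerup argument identifies `S_m` with a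
product of Gamma values up to a factor independent of `a` (`multiInt_mul_prod_Gamma`). Splitting off
the smallest variable gives `S_{m+1}(1, g) = S_m(1 + 2g, g)` (`multiInt_one_succ`), which fixes that
factor by induction on `m`.

Absolute convergence on the full domain is proved by induction on `m`, again by splitting off the
smallest variable (`lintegral_dens_lt_top`). Local domination makes the integral holomorphic in each
parameter separately, and the identity is continued first in `α`, then in `γ`
(`integral_integrand`). -/

/-! ### The Vandermonde product and permutations of coordinates. -/

lemma vdm_cons {m : ℕ} (t : ℝ) (y : Fin m → ℝ) :
    vdm (Fin.cons t y : Fin (m + 1) → ℝ) = (∏ j, (t - y j)) * vdm y := by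
  simp [vdm, Fin.prod_univ_succ, Fin.prod_Ioi_succ]

lemma abs_vdm_eq_abs_det {m : ℕ} (x : Fin m → ℝ) :
    |vdm x| = |(Matrix.vandermonde x).det| := by
  rw [Matrix.det_vandermonde, vdm, Finset.abs_prod, Finset.abs_prod]
  refine Finset.prod_congr rfl fun i _ => ?_
  rw [Finset.abs_prod, Finset.abs_prod]
  exact Finset.prod_congr rfl fun j _ => abs_sub_comm _ _

lemma abs_vdm_comp_perm {m : ℕ} (x : Fin m → ℝ) (σ : Equiv.Perm (Fin m)) :
    |vdm (x ∘ σ)| = |vdm x| := by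
  rw [abs_vdm_eq_abs_det, abs_vdm_eq_abs_det]
  have : Matrix.vandermonde (x ∘ σ) = (Matrix.vandermonde x).submatrix σ id := by
    ext i j; simp [Matrix.vandermonde_apply]
  rw [this, Matrix.det_permute, abs_mul]
  rcases Int.units_eq_one_or (Equiv.Perm.sign σ) with h | h <;> simp [h]

lemma abs_vdm_pos {m : ℕ} {x : Fin m → ℝ} (hx : Function.Injective x) : 0 < |vdm x| := by
  rw [abs_vdm_eq_abs_det]
  exact abs_pos.2 (Matrix.det_vandermonde_ne_zero_iff.2 hx)

lemma vdm_add_const {m : ℕ} (t : ℝ) (y : Fin m → ℝ) : vdm (fun j => t + y j) = vdm y := by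
  simp [vdm]

lemma continuous_vdm {m : ℕ} : Continuous (vdm (m := m)) := by
  unfold vdm; fun_prop

lemma measurable_vdm {m : ℕ} : Measurable (vdm (m := m)) := continuous_vdm.measurable

lemma measurableSet_posOrthant (m : ℕ) : MeasurableSet (posOrthant m) := by
  have : posOrthant m = ⋂ i, {x | 0 < x i} := by ext; simp [posOrthant]
  rw [this]
  exact MeasurableSet.iInter fun i => measurableSet_lt measurable_const (measurable_pi_apply i)

lemma measurePreserving_comp_perm {m : ℕ} (σ : Equiv.Perm (Fin m)) :
    MeasurePreserving (fun x : Fin m → ℝ => x ∘ σ) volume volume := by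
  have h := volume_measurePreserving_piCongrLeft (fun _ : Fin m => ℝ) σ.symm
  convert h using 1
  ext x i
  have := Equiv.piCongrLeft_apply_apply (fun _ : Fin m => ℝ) σ.symm x (σ i)
  simpa [MeasurableEquiv.coe_piCongrLeft] using this.symm

lemma measurableEmbedding_comp_perm {m : ℕ} (σ : Equiv.Perm (Fin m)) :
    MeasurableEmbedding (fun x : Fin m → ℝ => x ∘ σ) := by
  have h := (MeasurableEquiv.piCongrLeft (fun _ : Fin m => ℝ) σ.symm).measurableEmbedding
  convert h using 1
  ext x i
  have := Equiv.piCongrLeft_apply_apply (fun _ : Fin m => ℝ) σ.symm x (σ i)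
  simpa [MeasurableEquiv.coe_piCongrLeft] using this.symm

lemma integral_comp_perm {m : ℕ} {E : Type*} [NormedAddCommGroup E] [NormedSpace ℝ E]
    (σ : Equiv.Perm (Fin m)) (f : (Fin m → ℝ) → E) : ∫ x, f (x ∘ σ) = ∫ x, f x :=
  (measurePreserving_comp_perm σ).integral_comp (measurableEmbedding_comp_perm σ) f

/-- Each diagonal `x i = x j` is a proper subspace, hence null. Off the diagonals the smallest
coordinate is unique, `|vdm x|` is positive, and division by `x i - x j` is legitimate. -/
lemma ae_injective (m : ℕ) : ∀ᵐ x : Fin m → ℝ, Function.Injective x := by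
  have h : ∀ i j : Fin m, i ≠ j → ∀ᵐ x : Fin m → ℝ, x i ≠ x j := by
    intro i j hij
    let L : (Fin m → ℝ) →ₗ[ℝ] ℝ :=
      LinearMap.proj (R := ℝ) (φ := fun _ : Fin m => ℝ) i - LinearMap.proj j
    have hL : LinearMap.ker L ≠ ⊤ := by
      intro h
      have : L (Pi.single i 1) = 0 := by
        rw [← LinearMap.mem_ker, h]; trivial
      simp [L, hij.symm] at this
    have := Measure.addHaar_submodule (volume : Measure (Fin m → ℝ)) _ hL
    rw [ae_iff]
    convert this using 2
    ext x; simp [L, sub_eq_zero]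
  have : ∀ᵐ x : Fin m → ℝ, ∀ i j : Fin m, i ≠ j → x i ≠ x j := by
    rw [ae_all_iff]; intro i
    rw [ae_all_iff]; intro j
    by_cases hij : i = j
    · simp [hij]
    · filter_upwards [h i j hij] with x hx _ using hx
  filter_upwards [this] with x hx i j hij
  by_contra hne
  exact hx i j hne hij

/-! ### Splitting off the smallest coordinate. -/

/-- The part of the positive orthant where the `i`-th coordinate is the strict minimum. -/
def minPart {m : ℕ} (i : Fin m) : Set (Fin m → ℝ) :=
  {x | 0 < x i ∧ ∀ j, j ≠ i → x i < x j}

lemma measurableSet_minPart {m : ℕ} (i : Fin m) : MeasurableSet (minPart i) := by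
  have : minPart i = {x | 0 < x i} ∩ ⋂ j, ⋂ (_ : j ≠ i), {x | x i < x j} := by
    ext; simp [minPart]
  rw [this]
  exact (measurableSet_lt measurable_const (measurable_pi_apply i)).inter
    (MeasurableSet.iInter fun j => MeasurableSet.iInter fun _ =>
      measurableSet_lt (measurable_pi_apply i) (measurable_pi_apply j))

lemma posOrthant_ae_eq_iUnion_minPart (m : ℕ) :
    (posOrthant (m + 1) : Set (Fin (m + 1) → ℝ)) =ᵐ[volume] ⋃ i, minPart i := by
  filter_upwards [ae_injective (m + 1)] with x hx
  refine propext ⟨fun h => ?_, fun h => ?_⟩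
  · obtain ⟨i, hi⟩ := Finite.exists_min x
    refine mem_iUnion.2 ⟨i, h i, fun j hj => lt_of_le_of_ne (hi j) fun e => hj (hx e).symm⟩
  · obtain ⟨i, hi, hij⟩ := mem_iUnion.1 h
    intro j
    by_cases hj : j = i
    · exact hj ▸ hi
    · exact hi.trans (hij j hj)

lemma setLIntegral_minPart {m : ℕ} (i : Fin (m + 1)) (f : (Fin (m + 1) → ℝ) → ℝ≥0∞)
    (hsymm : ∀ (σ : Equiv.Perm (Fin (m + 1))) x, f (x ∘ σ) = f x) :
    ∫⁻ x in minPart i, f x = ∫⁻ x in minPart 0, f x := by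
  have h := (measurePreserving_comp_perm (Equiv.swap 0 i)).setLIntegral_comp_preimage_emb
    (measurableEmbedding_comp_perm _) f (minPart 0)
  rw [← h]
  have : (fun x : Fin (m + 1) → ℝ => x ∘ (Equiv.swap 0 i)) ⁻¹' minPart 0 = minPart i := by
    ext x
    simp only [minPart, mem_preimage, mem_ofPred_eq, Function.comp_apply, Equiv.swap_apply_left]
    refine and_congr_right fun _ => ⟨fun h j hj => ?_, fun h j hj => h _ ?_⟩
    · have := h (Equiv.swap 0 i j) (by
        intro e; apply hj
        simpa using congrArg (Equiv.swap 0 i) e)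
      simpa using this
    · intro e; apply hj
      simpa using congrArg (Equiv.swap 0 i) e
  simp only [this, hsymm]

/-- By symmetry the `m + 1` regions, one for each position of the minimum, contribute equally. With
the minimum `t` in position `0`, translating the other coordinates by `t` turns the region into a
product. -/
lemma lintegral_posOrthant_succ {m : ℕ} (f : (Fin (m + 1) → ℝ) → ℝ≥0∞) (hf : Measurable f)
    (hsymm : ∀ (σ : Equiv.Perm (Fin (m + 1))) x, f (x ∘ σ) = f x) :
    ∫⁻ x in posOrthant (m + 1), f x =
      (m + 1 : ℕ) * ∫⁻ t in Ioi (0 : ℝ), ∫⁻ y in posOrthant m,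
        f (Fin.cons t fun j => t + y j) := by
  rw [Measure.restrict_congr_set (posOrthant_ae_eq_iUnion_minPart m),
    lintegral_iUnion (fun i => measurableSet_minPart i), tsum_fintype,
    Finset.sum_congr rfl (fun i _ => setLIntegral_minPart i f hsymm)]
  · rw [Finset.sum_const, Finset.card_univ, Fintype.card_fin, nsmul_eq_mul]
    congr 1
    rw [← lintegral_indicator (measurableSet_minPart 0),
      ← (volume_preserving_piFinSuccAbove (fun _ => ℝ) 0).symm.lintegral_comp_emb
        (MeasurableEquiv.measurableEmbedding _), Measure.volume_eq_prod, lintegral_prod,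
      ← lintegral_indicator measurableSet_Ioi]
    · congr 1
      ext t
      simp only [MeasurableEquiv.piFinSuccAbove_symm_apply]
      rw [← lintegral_add_left_eq_self _ (fun _ => t)]
      by_cases ht : 0 < t
      · rw [indicator_of_mem (mem_Ioi.2 ht), ← lintegral_indicator (measurableSet_posOrthant m)]
        congr 1
        ext y
        have : (Fin.insertNthEquiv (fun _ : Fin (m + 1) => ℝ) 0) (t, (fun _ => t) + y) =
          (Fin.cons t fun j => t + y j) := by
          simp [Fin.insertNthEquiv]; rfl
        rw [this]
        have h2 : ((Fin.cons t fun j => t + y j : Fin (m + 1) → ℝ) ∈ minPart 0) ↔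
            y ∈ posOrthant m := by
          simp [minPart, posOrthant, ht, Fin.forall_fin_succ]
        by_cases hy : y ∈ posOrthant m
        · rw [indicator_of_mem hy, indicator_of_mem (h2.2 hy)]
        · rw [indicator_of_notMem hy, indicator_of_notMem (mt h2.1 hy)]
      · rw [indicator_of_notMem (by simpa using ht)]
        rw [lintegral_eq_zero_iff']
        · refine Filter.Eventually.of_forall fun y => indicator_of_notMem ?_ _
          simp [minPart, ht, Fin.insertNthEquiv]
        · refine Measurable.aemeasurable ?_
          refine (hf.indicator (measurableSet_minPart 0)).comp ?_
          refine (MeasurableEquiv.piFinSuccAbove (fun _ => ℝ) 0).symm.measurable.comp ?_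
          fun_prop
    · refine Measurable.aemeasurable ?_
      exact (hf.indicator (measurableSet_minPart 0)).comp
        (MeasurableEquiv.piFinSuccAbove (fun _ => ℝ) 0).symm.measurable
  · intro i j hij
    refine Set.disjoint_left.2 fun x hx hx' => ?_
    exact lt_asymm (hx.2 j hij.symm) (hx'.2 i hij)

/-! ### Absolute convergence for real parameters. -/

/-- The density of the exponential Selberg integral with real parameters and rate `c`. -/
def dens {m : ℕ} (a g c : ℝ) (x : Fin m → ℝ) : ℝ :=
  |vdm x| ^ (2 * g) * ∏ j, (x j ^ (a - 1) * Real.exp (-c * x j))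

lemma measurable_dens {m : ℕ} (a g c : ℝ) : Measurable (dens (m := m) a g c) := by
  unfold dens
  have := measurable_vdm (m := m)
  fun_prop

lemma dens_comp_perm {m : ℕ} (a g c : ℝ) (σ : Equiv.Perm (Fin m)) (x : Fin m → ℝ) :
    dens a g c (x ∘ σ) = dens a g c x := by
  rw [dens, dens, abs_vdm_comp_perm]
  congr 1
  exact Equiv.prod_comp σ fun j => x j ^ (a - 1) * Real.exp (-c * x j)

lemma dens_nonneg {m : ℕ} (a g c : ℝ) {x : Fin m → ℝ} (hx : x ∈ posOrthant m) :
    0 ≤ dens a g c x :=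
  mul_nonneg (Real.rpow_nonneg (abs_nonneg _) _) (Finset.prod_nonneg fun j _ =>
    mul_nonneg (Real.rpow_nonneg (hx j).le _) (Real.exp_pos _).le)

lemma dens_cons_add {m : ℕ} (a g c : ℝ) (t : ℝ) {y : Fin m → ℝ}
    (hy : y ∈ posOrthant m) :
    dens a g c (Fin.cons t fun j => t + y j : Fin (m + 1) → ℝ) =
      t ^ (a - 1) * Real.exp (-(c * (m + 1)) * t) * (|vdm y| ^ (2 * g) *
        ∏ j, (y j ^ (2 * g) * (t + y j) ^ (a - 1) * Real.exp (-c * y j))) := by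
  have h1 : |∏ j, (t - (t + y j))| = ∏ j, y j := by
    rw [Finset.abs_prod]
    exact Finset.prod_congr rfl fun j _ => by simp [abs_of_pos (hy j)]
  rw [dens, vdm_cons, vdm_add_const, abs_mul, h1,
    Real.mul_rpow (Finset.prod_nonneg fun j _ => (hy j).le) (abs_nonneg _),
    ← Real.finsetProd_rpow _ _ fun j _ => (hy j).le, Fin.prod_univ_succ]
  simp only [Fin.cons_zero, Fin.cons_succ]
  have h2 : Real.exp (-(c * (m + 1)) * t) = Real.exp (-c * t) * ∏ _j : Fin m, Real.exp (-c * t) := by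
    rw [Finset.prod_const, Finset.card_univ, Fintype.card_fin, ← Real.exp_nat_mul, ← Real.exp_add]
    congr 1; ring
  have h3 : ∀ j, Real.exp (-c * (t + y j)) = Real.exp (-c * t) * Real.exp (-c * y j) := by
    intro j; rw [← Real.exp_add]; congr 1; ring
  simp only [h2, h3, Finset.prod_mul_distrib]
  ring

lemma exists_rpow_le_exp (s : ℝ) {ε : ℝ} (hε : 0 < ε) :
    ∃ C : ℝ, 0 < C ∧ ∀ t : ℝ, 0 < t → (1 + t) ^ s ≤ C * Real.exp (ε * t) := by
  obtain ⟨n, hn⟩ := exists_nat_gt s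
  refine ⟨(n.factorial / ε ^ n) * Real.exp ε, by positivity, fun t ht => ?_⟩
  have h1 : (1 + t) ^ s ≤ (1 + t) ^ n := by
    rw [← Real.rpow_natCast]
    exact Real.rpow_le_rpow_of_exponent_le (by linarith) hn.le
  refine h1.trans ?_
  have h2 := Real.pow_div_factorial_le_exp (ε * (1 + t)) (by positivity) n
  rw [mul_assoc, ← Real.exp_add, show ε + ε * t = ε * (1 + t) by ring]
  rw [mul_pow, div_le_iff₀ (by positivity)] at h2
  rw [div_mul_eq_mul_div, le_div_iff₀ (by positivity)]
  linarith

/-- Here `b` is the part of the singular exponent `1 - a` charged to `t` in each factor `(t + y_j) ^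
(a - 1)`. The bound `m * b < a` makes the resulting power of `t` integrable at `0`; the last bound
is the convergence condition for the remaining `m` variables. -/
lemma exists_splitting_exponent {a g : ℝ} {m : ℕ} (ha : 0 < a) (ha1 : a ≤ 1)
    (hg : -1 < (m + 1) * g) (hag : 0 < a + m * g) :
    ∃ b : ℝ, 0 ≤ b ∧ b ≤ 1 - a ∧ m * b < a ∧ 0 < a + b + (m + 1) * g := by
  by_cases h : m * (1 - a) < a
  · exact ⟨1 - a, by linarith, le_rfl, h, by linarith⟩
  · push Not at h
    have hm : (0 : ℝ) < m := by
      rcases Nat.eq_zero_or_pos m with rfl | hm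
      · norm_num at h; linarith
      · exact_mod_cast hm
    have h2 : a / m ≤ 1 - a := by rw [div_le_iff₀ hm]; linarith
    -- After clearing `m` this reads `0 < (m + 1) * (a + m * g)`, which is `hag`.
    have h3 : -(a + (m + 1) * g) < a / m := by
      rw [lt_div_iff₀ hm]; nlinarith
    have h4 : 0 < a / m := by positivity
    obtain ⟨b, hb1, hb2⟩ := exists_between (max_lt h4 h3)
    refine ⟨b, (le_max_left _ _).trans hb1.le, by linarith, ?_, ?_⟩
    · rw [lt_div_iff₀ hm] at hb2; linarith
    · linarith [(le_max_right _ _).trans_lt hb1]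

/-- A bound of `(t + y) ^ (a - 1)` by a product, with exponents that keep the parameters of the
Selberg integral in the domain of convergence. -/
lemma exists_add_rpow_le {a g c : ℝ} {m : ℕ} (hc : 0 < c) (ha : 0 < a)
    (hg : -1 < (m + 1) * g) (hag : 0 < a + m * g) :
    ∃ b r C : ℝ, 0 ≤ C ∧ 0 < 1 + r ∧ m * b < a ∧ 0 < 1 + r + (m + 1) * g ∧
      ∀ t y : ℝ, 0 < t → 0 < y →
        (t + y) ^ (a - 1) ≤ C * (t ^ (-b) * y ^ r * Real.exp (c * (t + y))) := by
  by_cases ha1 : a ≤ 1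
  · obtain ⟨b, hb0, hb1, hb2, hb3⟩ := exists_splitting_exponent ha ha1 hg hag
    refine ⟨b, a - 1 + b, 1, zero_le_one, by linarith, hb2, by linarith, fun t y ht hy => ?_⟩
    have h1 : (t + y) ^ (a - 1) = (t + y) ^ (-b) * (t + y) ^ (a - 1 + b) := by
      rw [← Real.rpow_add (by positivity)]; congr 1; ring
    have h2 : (t + y) ^ (-b) ≤ t ^ (-b) :=
      Real.rpow_le_rpow_of_nonpos ht (by linarith) (by linarith)
    have h3 : (t + y) ^ (a - 1 + b) ≤ y ^ (a - 1 + b) :=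
      Real.rpow_le_rpow_of_nonpos hy (by linarith) (by linarith)
    have h4 : 1 ≤ Real.exp (c * (t + y)) := Real.one_le_exp (by positivity)
    rw [h1, one_mul]
    calc _ ≤ t ^ (-b) * y ^ (a - 1 + b) := by gcongr
      _ ≤ _ := le_mul_of_one_le_right (by positivity) h4
  · push Not at ha1
    obtain ⟨C, hC, h⟩ := exists_rpow_le_exp (a - 1) hc
    refine ⟨0, 0, C, hC.le, by norm_num, by simpa using ha, by linarith, fun t y ht hy => ?_⟩
    have := h (t + y) (by positivity)
    simp only [neg_zero, Real.rpow_zero, one_mul]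
    refine le_trans ?_ this
    exact Real.rpow_le_rpow (by positivity) (by linarith) (by linarith)

lemma lintegral_rpow_mul_exp_lt_top {s c : ℝ} (hs : -1 < s) (hc : 0 < c) :
    ∫⁻ t in Ioi (0 : ℝ), ENNReal.ofReal (t ^ s * Real.exp (-c * t)) < ∞ := by
  have h := integrableOn_rpow_mul_exp_neg_mul_rpow hs one_pos hc
  simp only [Real.rpow_one] at h
  exact h.lintegral_lt_top

/-- Once the minimum `t` is split off, bounding each `(t + y_j) ^ (a - 1)` by a product dominates
the integral by a Gamma integral in `t` times an integral of the same type in `m` variables. Each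
step spends half of the exponential, so the rate `c` must be arbitrary. The other conditions are
imposed only for `1 ≤ m`, since at `m = 0` the last one would read `0 < a - g` and could fail. -/
theorem lintegral_dens_lt_top (m : ℕ) : ∀ (a g c : ℝ), 0 < c →
    (1 ≤ m → 0 < a ∧ -1 < m * g ∧ 0 < a + (m - 1) * g) →
    ∫⁻ x in posOrthant m, ENNReal.ofReal (dens a g c x) < ∞ := by
  induction m with
  | zero =>
    intro a g c _ _
    refine setLIntegral_lt_top_of_le_nnreal (by
      refine ne_top_of_le_ne_top ?_ (measure_mono (subset_univ _))
      simp [volume_pi]) ⟨1, fun x _ => ?_⟩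
    simp [dens, vdm]
  | succ m ih =>
    intro a g c hc h
    obtain ⟨ha, hg, hag⟩ := h (by omega)
    push_cast at hg hag
    rw [add_sub_cancel_right] at hag
    obtain ⟨b, r, C, hC, hr0, hb, hr, hbound⟩ :=
      exists_add_rpow_le (c := c / 2) (by positivity) ha hg hag
    rw [lintegral_posOrthant_succ _ (measurable_dens a g c).ennreal_ofReal
      (fun σ x => by rw [dens_comp_perm])]
    refine ENNReal.mul_lt_top (by simp) ?_
    have key : ∀ t : ℝ, 0 < t → ∀ y ∈ posOrthant m,
        dens a g c (Fin.cons t fun j => t + y j : Fin (m + 1) → ℝ) ≤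
          C ^ m * (t ^ (a - 1 - m * b) * Real.exp (-(c / 2) * t)) *
            dens (1 + r + 2 * g) g (c / 2) y := by
      intro t ht y hy
      have h1 : ∏ j, (y j ^ (2 * g) * (t + y j) ^ (a - 1) * Real.exp (-c * y j)) ≤
          ∏ j, ((C * t ^ (-b) * Real.exp (c / 2 * t)) *
            (y j ^ (1 + r + 2 * g - 1) * Real.exp (-(c / 2) * y j))) := by
        refine Finset.prod_le_prod (fun j _ => ?_) fun j _ => ?_
        · have := hy j; positivity
        · have hj : 0 < y j := hy j
          calc y j ^ (2 * g) * (t + y j) ^ (a - 1) * Real.exp (-c * y j)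
              ≤ y j ^ (2 * g) * (C * (t ^ (-b) * y j ^ r * Real.exp (c / 2 * (t + y j)))) *
                Real.exp (-c * y j) := by
                have := hbound t (y j) ht hj
                gcongr
            _ = _ := by
              rw [show 1 + r + 2 * g - 1 = 2 * g + r by ring, Real.rpow_add hj,
                show c / 2 * (t + y j) = c / 2 * t + c / 2 * y j by ring, Real.exp_add,
                show -(c / 2) * y j = c / 2 * y j + -c * y j by ring, Real.exp_add]
              ring
      rw [dens_cons_add a g c t hy]
      calc _ ≤ t ^ (a - 1) * Real.exp (-(c * (m + 1)) * t) * (|vdm y| ^ (2 * g) *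
            ∏ j, ((C * t ^ (-b) * Real.exp (c / 2 * t)) *
            (y j ^ (1 + r + 2 * g - 1) * Real.exp (-(c / 2) * y j)))) := by gcongr
        _ = C ^ m * (t ^ (a - 1 - m * b) * Real.exp (-(c * (m + 1)) * t + m * (c / 2 * t))) *
            dens (1 + r + 2 * g) g (c / 2) y := by
          rw [Finset.prod_mul_distrib, Finset.prod_const, Finset.card_univ, Fintype.card_fin,
            dens, mul_pow, mul_pow, Real.exp_add, Real.exp_nat_mul, ← Real.rpow_mul_natCast ht.le,
            show a - 1 - m * b = a - 1 + -b * m by ring, Real.rpow_add ht]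
          ring
        _ ≤ _ := by
          have := dens_nonneg (1 + r + 2 * g) g (c / 2) hy
          gcongr
          have : 0 ≤ (m : ℝ) * (c * t) := by positivity
          nlinarith [mul_pos hc ht]
    have hfin : ∫⁻ y in posOrthant m, ENNReal.ofReal (dens (1 + r + 2 * g) g (c / 2) y) < ∞ := by
      refine ih _ _ _ (by positivity) fun hm => ?_
      have hm' : (1 : ℝ) ≤ m := by exact_mod_cast hm
      rcases le_or_gt 0 g with h0 | h0
      · exact ⟨by linarith, by nlinarith, by nlinarith⟩
      · exact ⟨by nlinarith, by nlinarith, by nlinarith⟩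
    calc _ ≤ ∫⁻ t in Ioi (0 : ℝ), ∫⁻ y in posOrthant m,
          ENNReal.ofReal (C ^ m * (t ^ (a - 1 - m * b) * Real.exp (-(c / 2) * t))) *
            ENNReal.ofReal (dens (1 + r + 2 * g) g (c / 2) y) := by
          refine setLIntegral_mono' measurableSet_Ioi fun t ht => ?_
          refine setLIntegral_mono' (measurableSet_posOrthant m) fun y hy => ?_
          have ht : 0 < t := ht
          rw [← ENNReal.ofReal_mul (by positivity)]
          exact ENNReal.ofReal_le_ofReal (key t ht y hy)
      _ = (∫⁻ t in Ioi (0 : ℝ), ENNReal.ofReal (C ^ m * (t ^ (a - 1 - m * b) *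
            Real.exp (-(c / 2) * t)))) *
          ∫⁻ y in posOrthant m, ENNReal.ofReal (dens (1 + r + 2 * g) g (c / 2) y) := by
          rw [← lintegral_mul_const _ (by fun_prop)]
          exact lintegral_congr fun t =>
            lintegral_const_mul _ (measurable_dens _ _ _).ennreal_ofReal
      _ < ∞ := by
          refine ENNReal.mul_lt_top ?_ hfin
          simp_rw [ENNReal.ofReal_mul (pow_nonneg hC m)]
          rw [lintegral_const_mul _ (by fun_prop)]
          exact ENNReal.mul_lt_top (by simp)
            (lintegral_rpow_mul_exp_lt_top (by linarith) (by positivity))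

lemma integrableOn_dens {m : ℕ} {a g c : ℝ} (hc : 0 < c) (ha : 0 < a) (hg : -1 < m * g)
    (hag : 0 < a + (m - 1) * g) : IntegrableOn (dens (m := m) a g c) (posOrthant m) := by
  refine ⟨(measurable_dens a g c).aestronglyMeasurable, ?_⟩
  rw [hasFiniteIntegral_iff_ofReal]
  · exact lintegral_dens_lt_top m a g c hc fun _ => ⟨ha, hg, hag⟩
  · exact (ae_restrict_iff' (measurableSet_posOrthant m)).2
      (Filter.Eventually.of_forall fun x hx => dens_nonneg a g c hx)

/-! ### Integration by parts for densities with individual exponents. -/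

/-- The function `t ^ s * exp (-c * t)` on the positive half-line, extended by zero. -/
def gammaWeight (c s t : ℝ) : ℝ := (Ioi (0 : ℝ)).indicator (fun t => t ^ s * Real.exp (-c * t)) t

lemma gammaWeight_of_pos (c s : ℝ) {t : ℝ} (ht : 0 < t) :
    gammaWeight c s t = t ^ s * Real.exp (-c * t) := indicator_of_mem (mem_Ioi.2 ht) _

lemma gammaWeight_of_nonpos (c s : ℝ) {t : ℝ} (ht : t ≤ 0) : gammaWeight c s t = 0 :=
  indicator_of_notMem (by simpa using ht) _

lemma gammaWeight_nonneg (c s t : ℝ) : 0 ≤ gammaWeight c s t :=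
  indicator_nonneg (fun _ ht => mul_nonneg (Real.rpow_nonneg (le_of_lt ht) _) (Real.exp_pos _).le) _

lemma gammaWeight_add_one (c s t : ℝ) : gammaWeight c (s + 1) t = t * gammaWeight c s t := by
  rcases lt_or_ge 0 t with ht | ht
  · rw [gammaWeight_of_pos _ _ ht, gammaWeight_of_pos _ _ ht, Real.rpow_add_one ht.ne']; ring
  · simp [gammaWeight_of_nonpos _ _ ht]

lemma measurable_gammaWeight (c s : ℝ) : Measurable (gammaWeight c s) :=
  Measurable.indicator (by fun_prop) measurableSet_Ioi

lemma integrable_gammaWeight {c s : ℝ} (hc : 0 < c) (hs : -1 < s) :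
    Integrable (gammaWeight c s) := by
  have h := integrableOn_rpow_mul_exp_neg_mul_rpow hs one_pos hc
  simp only [Real.rpow_one] at h
  exact h.integrable_indicator measurableSet_Ioi

/-- For `s > 1` the extension by zero is differentiable at `0` as well, so integration by parts can
run over the whole space without boundary terms. -/
lemma hasDerivAt_gammaWeight (c : ℝ) {s : ℝ} (hs : 1 < s) (t : ℝ) :
    HasDerivAt (gammaWeight c s) (s * gammaWeight c (s - 1) t - c * gammaWeight c s t) t := by
  rcases lt_trichotomy t 0 with ht | rfl | ht
  · rw [gammaWeight_of_nonpos _ _ ht.le, gammaWeight_of_nonpos _ _ ht.le]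
    simp only [mul_zero, sub_zero]
    refine (hasDerivAt_const t (0 : ℝ)).congr_of_eventuallyEq ?_
    filter_upwards [Iio_mem_nhds ht] with u hu using gammaWeight_of_nonpos _ _ (le_of_lt hu)
  · rw [gammaWeight_of_nonpos _ _ le_rfl, gammaWeight_of_nonpos _ _ le_rfl]
    simp only [mul_zero, sub_zero]
    have h1 : HasDerivAt (fun x : ℝ => |x| ^ s * Real.exp (-c * x)) 0 0 := by
      have := (hasDerivAt_abs_rpow 0 hs).fun_mul
        (((hasDerivAt_id (0 : ℝ)).const_mul (-c)).exp)
      simpa [Real.zero_rpow (by linarith : s ≠ 0)] using this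
    rw [hasDerivAt_iff_isLittleO] at h1 ⊢
    refine (Asymptotics.IsBigO.of_bound 1 ?_).trans_isLittleO h1
    refine Filter.Eventually.of_forall fun u => ?_
    rcases lt_or_ge 0 u with hu | hu
    · simp [gammaWeight_of_pos _ _ hu, gammaWeight_of_nonpos _ _ (le_refl (0 : ℝ)), abs_of_pos hu,
        Real.zero_rpow (by linarith : s ≠ 0)]
    · simp [gammaWeight_of_nonpos _ _ hu, gammaWeight_of_nonpos _ _ (le_refl (0 : ℝ))]
  · have h1 : HasDerivAt (fun x : ℝ => x ^ s * Real.exp (-c * x))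
        (s * t ^ (s - 1) * Real.exp (-c * t) + t ^ s * (Real.exp (-c * t) * (-c))) t := by
      have := (Real.hasDerivAt_rpow_const (p := s) (Or.inl ht.ne')).fun_mul
        (((hasDerivAt_id t).const_mul (-c)).exp)
      simpa using this
    rw [gammaWeight_of_pos _ _ ht, gammaWeight_of_pos _ _ ht]
    refine (h1.congr_of_eventuallyEq ?_).congr_deriv (by ring)
    filter_upwards [Ioi_mem_nhds ht] with u hu using gammaWeight_of_pos _ _ hu

/-- The quotient form survives at `t = y`, where `x / 0 = 0` agrees with the true derivative. With
`p = 2 * g` this is the source of the restriction `1 / 2 < g`. -/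
lemma hasDerivAt_abs_sub_rpow {p : ℝ} (hp : 1 < p) (y t : ℝ) :
    HasDerivAt (fun u : ℝ => |u - y| ^ p) (p * (|t - y| ^ p / (t - y))) t := by
  have h : HasDerivAt (fun u : ℝ => |u - y| ^ p) _ t :=
    (hasDerivAt_abs_rpow (t - y) hp).comp_sub_const t y
  refine h.congr_deriv ?_
  rcases eq_or_ne (t - y) 0 with h0 | h0
  · simp [h0]
  · rw [Real.rpow_sub (abs_pos.2 h0), Real.rpow_two, sq_abs]
    field_simp

lemma hasDerivAt_prod_abs_sub_rpow {m : ℕ} {p : ℝ} (hp : 1 < p) (y : Fin m → ℝ) (t : ℝ) :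
    HasDerivAt (fun u : ℝ => ∏ j, |u - y j| ^ p)
      (∑ j, p * ((∏ i, |t - y i| ^ p) / (t - y j))) t := by
  refine (HasDerivAt.fun_finsetProd (u := Finset.univ)
    (fun j _ => hasDerivAt_abs_sub_rpow hp (y j) t)).congr_deriv ?_
  refine Finset.sum_congr rfl fun j _ => ?_
  rw [← Finset.mul_prod_erase _ _ (Finset.mem_univ j), smul_eq_mul]
  ring

/-- The density of the Selberg integral with an exponent for each coordinate, extended by zero
outside the positive orthant. -/
def multiDens {m : ℕ} (g : ℝ) (e : Fin m → ℝ) (x : Fin m → ℝ) : ℝ :=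
  |vdm x| ^ (2 * g) * ∏ j, gammaWeight 1 (e j) (x j)

/-- The integral of `multiDens`. -/
def multiInt {m : ℕ} (g : ℝ) (e : Fin m → ℝ) : ℝ := ∫ x, multiDens g e x

lemma multiDens_comp_perm {m : ℕ} (g : ℝ) (e x : Fin m → ℝ) (σ : Equiv.Perm (Fin m)) :
    multiDens g (e ∘ σ) (x ∘ σ) = multiDens g e x := by
  rw [multiDens, multiDens, abs_vdm_comp_perm]
  congr 1
  exact Equiv.prod_comp σ fun j => gammaWeight 1 (e j) (x j)

lemma multiInt_comp_perm {m : ℕ} (g : ℝ) (e : Fin m → ℝ) (σ : Equiv.Perm (Fin m)) :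
    multiInt g (e ∘ σ) = multiInt g e := by
  rw [multiInt, ← integral_comp_perm σ]
  simp only [multiDens_comp_perm]
  rfl

lemma multiDens_update_add_one {m : ℕ} (g : ℝ) (e x : Fin m → ℝ) (p : Fin m) :
    multiDens g (Function.update e p (e p + 1)) x = x p * multiDens g e x := by
  rw [multiDens, multiDens, ← Finset.mul_prod_erase _ _ (Finset.mem_univ p),
    ← Finset.mul_prod_erase _ (fun j => gammaWeight 1 (e j) (x j)) (Finset.mem_univ p),
    Function.update_self, gammaWeight_add_one,
    Finset.prod_congr rfl fun j hj => by rw [Function.update_of_ne (Finset.ne_of_mem_erase hj)]]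
  ring

lemma measurable_multiDens {m : ℕ} (g : ℝ) (e : Fin m → ℝ) : Measurable (multiDens g e) := by
  have h1 := measurable_vdm (m := m)
  have h2 := fun j => measurable_gammaWeight 1 (e j)
  unfold multiDens
  fun_prop

lemma one_le_prod_one_add {m : ℕ} {x : Fin m → ℝ} {s : Finset (Fin m)}
    (hx : x ∈ posOrthant m) : 1 ≤ ∏ k ∈ s, (1 + x k) := by
  have h : ∏ k ∈ s, (1 : ℝ) ≤ ∏ k ∈ s, (1 + x k) :=
    Finset.prod_le_prod (fun _ _ => zero_le_one) fun k _ => by linarith [hx k]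
  simpa using h

lemma abs_sub_le_prod_one_add {m : ℕ} {x : Fin m → ℝ} (hx : x ∈ posOrthant m) (i j : Fin m) :
    |x i - x j| ≤ ∏ k, (1 + x k) := by
  have h : ∀ i, x i ≤ ∏ k, (1 + x k) := fun i => by
    rw [← Finset.mul_prod_erase _ _ (Finset.mem_univ i)]
    have h1 : 1 ≤ ∏ k ∈ Finset.univ.erase i, (1 + x k) := one_le_prod_one_add hx
    have := hx i
    nlinarith
  rw [abs_le]
  constructor <;> linarith [h i, h j, hx i, hx j]

/-- Half of each exponential absorbs the polynomial growth, leaving a product of one-variable Gamma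
weights. -/
lemma integrable_of_le_prod {m : ℕ} {e : Fin m → ℝ} (he : ∀ j, -1 < e j) (N : ℝ)
    {F : (Fin m → ℝ) → ℝ} (hF : Measurable F)
    (hbound : ∀ x ∈ posOrthant m, |F x| ≤ (∏ k, (1 + x k)) ^ N) :
    Integrable fun x => F x * ∏ j, gammaWeight 1 (e j) (x j) := by
  obtain ⟨C, hC, hCb⟩ := exists_rpow_le_exp N (ε := 1 / 2) (by norm_num)
  have hint : Integrable fun x : Fin m → ℝ => ∏ j, C * gammaWeight (1 / 2) (e j) (x j) :=
    Integrable.fintype_prod (f := fun j t => C * gammaWeight (1 / 2) (e j) t) fun j =>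
      (integrable_gammaWeight (by norm_num) (he j)).const_mul C
  have h2 := fun j => measurable_gammaWeight 1 (e j)
  refine hint.mono' (by fun_prop) (Filter.Eventually.of_forall fun x => ?_)
  rw [norm_mul, Real.norm_eq_abs, Real.norm_eq_abs,
    abs_of_nonneg (Finset.prod_nonneg fun j _ => gammaWeight_nonneg _ _ _)]
  by_cases hx : x ∈ posOrthant m
  · calc _ ≤ (∏ k, (1 + x k)) ^ N * ∏ j, gammaWeight 1 (e j) (x j) :=
        mul_le_mul_of_nonneg_right (hbound x hx)
          (Finset.prod_nonneg fun j _ => gammaWeight_nonneg _ _ _)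
      _ = ∏ j, (1 + x j) ^ N * gammaWeight 1 (e j) (x j) := by
        rw [← Real.finsetProd_rpow _ _ fun j _ => by linarith [hx j], Finset.prod_mul_distrib]
      _ ≤ _ := by
        refine Finset.prod_le_prod (fun j _ => mul_nonneg
          (Real.rpow_nonneg (by linarith [hx j]) _) (gammaWeight_nonneg _ _ _)) fun j _ => ?_
        have hj : 0 < x j := hx j
        rw [gammaWeight_of_pos _ _ hj, gammaWeight_of_pos _ _ hj]
        calc _ ≤ C * Real.exp (1 / 2 * x j) * (x j ^ e j * Real.exp (-1 * x j)) := by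
              have := hCb (x j) hj
              gcongr
          _ = _ := by
              rw [show -(1 / 2) * x j = 1 / 2 * x j + -1 * x j by ring, Real.exp_add]; ring
  · obtain ⟨i, hi⟩ : ∃ i, x i ≤ 0 := by simpa [posOrthant] using hx
    rw [Finset.prod_eq_zero (Finset.mem_univ i) (gammaWeight_of_nonpos _ _ hi), mul_zero]
    exact Finset.prod_nonneg fun j _ => mul_nonneg hC.le (gammaWeight_nonneg _ _ _)

lemma abs_vdm_le {m : ℕ} {x : Fin m → ℝ} (hx : x ∈ posOrthant m) :
    |vdm x| ≤ (∏ k, (1 + x k)) ^ (m * m) := by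
  have h1 := one_le_prod_one_add (s := Finset.univ) hx
  rw [vdm, Finset.abs_prod]
  calc _ ≤ ∏ i : Fin m, (∏ k, (1 + x k)) ^ m := by
        refine Finset.prod_le_prod (fun _ _ => abs_nonneg _) fun i _ => ?_
        rw [Finset.abs_prod]
        calc _ ≤ ∏ j ∈ Finset.Ioi i, ∏ k, (1 + x k) :=
              Finset.prod_le_prod (fun _ _ => abs_nonneg _) fun j _ => abs_sub_le_prod_one_add hx i j
          _ ≤ _ := by
              rw [Finset.prod_const]
              refine pow_le_pow_right₀ h1 ?_
              simpa using Finset.card_le_univ (Finset.Ioi i)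
    _ = _ := by simp [pow_mul]

lemma integrable_multiDens {m : ℕ} {g : ℝ} (hg : 0 ≤ g) {e : Fin m → ℝ} (he : ∀ j, -1 < e j) :
    Integrable (multiDens g e) := by
  refine integrable_of_le_prod he ((m * m : ℕ) * (2 * g)) (F := fun x => |vdm x| ^ (2 * g)) ?_ ?_
  · have h1 := measurable_vdm (m := m)
    fun_prop
  · intro x hx
    rw [abs_of_nonneg (by positivity), Real.rpow_mul (x := ∏ k, (1 + x k)) (by
      linarith [one_le_prod_one_add (s := Finset.univ) hx]), Real.rpow_natCast]
    exact Real.rpow_le_rpow (abs_nonneg _) (abs_vdm_le hx) (by positivity)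

lemma abs_vdm_cons_rpow {m : ℕ} (t : ℝ) (y : Fin m → ℝ) (p : ℝ) :
    |vdm (Fin.cons t y : Fin (m + 1) → ℝ)| ^ p = (∏ j, |t - y j| ^ p) * |vdm y| ^ p := by
  rw [vdm_cons, abs_mul, Real.mul_rpow (abs_nonneg _) (abs_nonneg _), Finset.abs_prod,
    Real.finsetProd_rpow _ _ fun j _ => abs_nonneg _]

/-- Since `2 * g ≥ 1`, the factor `|x 0 - x j.succ| ^ (2 * g)` cancels the denominator and the
quotient still grows at most polynomially. -/
lemma integrable_multiDens_div {m : ℕ} {g : ℝ} (hg : 1 / 2 ≤ g) {e : Fin (m + 1) → ℝ}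
    (he : ∀ j, -1 < e j) (j : Fin m) :
    Integrable fun x => multiDens g e x / (x 0 - x j.succ) := by
  have hm : Measurable fun x : Fin (m + 1) → ℝ => |vdm x| ^ (2 * g) / (x 0 - x j.succ) := by
    have h1 := measurable_vdm (m := m + 1)
    fun_prop
  refine (integrable_of_le_prod he (m * (2 * g) + (m * m : ℕ) * (2 * g)) hm ?_).congr
    (Filter.Eventually.of_forall fun x => ?_)
  · intro x hx
    have h1 := one_le_prod_one_add (s := Finset.univ) hx
    have hx' : Fin.tail x ∈ posOrthant m := fun i => hx i.succ
    set s := ∏ k, (1 + x k) with hs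
    have hts : ∏ k, (1 + Fin.tail x k) ≤ s := by
      rw [hs, Fin.prod_univ_succ]
      exact le_mul_of_one_le_left (by linarith [one_le_prod_one_add (s := Finset.univ) hx']) (by linarith [hx 0])
    have hV : |vdm (Fin.tail x)| ^ (2 * g) ≤ s ^ ((m * m : ℕ) * (2 * g)) := by
      rw [Real.rpow_mul (x := s) (by linarith), Real.rpow_natCast]
      refine Real.rpow_le_rpow (abs_nonneg _) ((abs_vdm_le hx').trans ?_) (by positivity)
      gcongr
      linarith [one_le_prod_one_add (s := Finset.univ) hx']
    have hfac : ∀ i : Fin m, |x 0 - x i.succ| ≤ s := fun i => abs_sub_le_prod_one_add hx 0 i.succ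
    have hP : (∏ i, |x 0 - Fin.tail x i| ^ (2 * g)) / |x 0 - x j.succ| ≤ s ^ (m * (2 * g)) := by
      rw [← Finset.mul_prod_erase _ _ (Finset.mem_univ j), mul_comm, mul_div_assoc]
      have h2 : ∏ i ∈ Finset.univ.erase j, |x 0 - Fin.tail x i| ^ (2 * g) ≤
          ∏ i ∈ Finset.univ.erase j, s ^ (2 * g) :=
        Finset.prod_le_prod (fun _ _ => by positivity) fun i _ =>
          Real.rpow_le_rpow (abs_nonneg _) (hfac i) (by linarith)
      have h3 : |x 0 - Fin.tail x j| ^ (2 * g) / |x 0 - x j.succ| ≤ s ^ (2 * g) := by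
        rcases (abs_nonneg (x 0 - x j.succ)).eq_or_lt with h0 | h0
        · rw [← h0]; simp; positivity
        · have : |x 0 - Fin.tail x j| ^ (2 * g) / |x 0 - x j.succ| =
              |x 0 - x j.succ| ^ (2 * g - 1) := by
            rw [Real.rpow_sub_one h0.ne']; rfl
          rw [this]
          exact (Real.rpow_le_rpow h0.le (hfac j) (by linarith)).trans
            (Real.rpow_le_rpow_of_exponent_le h1 (by linarith))
      calc _ ≤ (∏ i ∈ Finset.univ.erase j, s ^ (2 * g)) * s ^ (2 * g) := by
            gcongr
        _ = s ^ (m * (2 * g)) := by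
            rw [mul_comm, Finset.mul_prod_erase _ (fun _ => s ^ (2 * g)) (Finset.mem_univ j),
              Finset.prod_const, Finset.card_univ, Fintype.card_fin, mul_comm (m : ℝ),
              Real.rpow_mul_natCast (by linarith)]
    have hx0 : x = Fin.cons (x 0) (Fin.tail x) := (Fin.cons_self_tail x).symm
    rw [abs_div, abs_of_nonneg (a := |vdm x| ^ (2 * g)) (by positivity), Real.rpow_add (by linarith)]
    nth_rw 1 [hx0]
    rw [abs_vdm_cons_rpow, mul_div_right_comm]
    gcongr
  · simp only [multiDens]; ring

lemma hasLineDerivAt_multiDens {m : ℕ} {g : ℝ} (hg : 1 / 2 < g) {f : Fin (m + 1) → ℝ}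
    (hf : 0 < f 0) (x : Fin (m + 1) → ℝ) :
    HasLineDerivAt ℝ (multiDens g (Function.update f 0 (f 0 + 1)))
      ((f 0 + 1) * multiDens g f x - multiDens g (Function.update f 0 (f 0 + 1)) x +
        ∑ j : Fin m, 2 * g *
          (multiDens g (Function.update f 0 (f 0 + 1)) x / (x 0 - x j.succ))) x
      (Pi.single 0 1) := by
  obtain ⟨t, y, rfl⟩ : ∃ t y, x = Fin.cons t y := ⟨_, _, (Fin.cons_self_tail x).symm⟩
  have hform : ∀ (e : Fin (m + 1) → ℝ) (u : ℝ), multiDens g e (Fin.cons u y) =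
      (∏ j, |u - y j| ^ (2 * g)) * gammaWeight 1 (e 0) u *
        (|vdm y| ^ (2 * g) * ∏ j : Fin m, gammaWeight 1 (e j.succ) (y j)) := by
    intro e u
    rw [multiDens, abs_vdm_cons_rpow, Fin.prod_univ_succ]
    simp only [Fin.cons_zero, Fin.cons_succ]
    ring
  have hline : ∀ u : ℝ, (Fin.cons t y : Fin (m + 1) → ℝ) + u • Pi.single 0 1 =
      Fin.cons (t + u) y := by
    intro u
    ext i
    refine Fin.cases ?_ (fun i => ?_) i <;> simp
  have hd := (((hasDerivAt_prod_abs_sub_rpow (p := 2 * g) (by linarith) y t).fun_mul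
    (hasDerivAt_gammaWeight 1 (s := f 0 + 1) (by linarith) t)).mul_const
      (|vdm y| ^ (2 * g) * ∏ j : Fin m, gammaWeight 1 (f j.succ) (y j)))
  unfold HasLineDerivAt
  simp only [hline, hform, Function.update_self, Fin.cons_zero, Fin.cons_succ]
  have hup : ∀ j : Fin m, Function.update f 0 (f 0 + 1) j.succ = f j.succ := fun j => by
    rw [Function.update_of_ne (Fin.succ_ne_zero j)]
  simp only [hup]
  rw [← add_zero t] at hd
  have h := hd.comp_const_add t 0
  refine h.congr_deriv ?_
  rw [add_zero, add_sub_cancel_right, Finset.sum_mul]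
  generalize (|vdm y| ^ (2 * g) * ∏ j : Fin m, gammaWeight 1 (f j.succ) (y j)) = Q
  rw [add_mul, Finset.sum_mul]
  refine (add_comm _ _).trans (congrArg₂ (· + ·) ?_ ?_)
  · ring
  · refine Finset.sum_congr rfl fun j _ => ?_
    ring

lemma multiInt_integration_by_parts {m : ℕ} {g : ℝ} (hg : 1 / 2 < g) {f : Fin (m + 1) → ℝ}
    (hf : 0 < f 0) (hf' : ∀ j, -1 < f j) :
    multiInt g (Function.update f 0 (f 0 + 1)) = (f 0 + 1) * multiInt g f +
      ∑ j : Fin m, 2 * g *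
        ∫ x, multiDens g (Function.update f 0 (f 0 + 1)) x / (x 0 - x j.succ) := by
  have he : ∀ j, -1 < Function.update f 0 (f 0 + 1) j := by
    intro j
    by_cases hj : j = 0
    · subst hj; simp; linarith
    · rw [Function.update_of_ne hj]; exact hf' j
  set e := Function.update f 0 (f 0 + 1) with hedef
  have hA := (integrable_multiDens (g := g) (by linarith) hf').const_mul (f 0 + 1)
  have hB := integrable_multiDens (g := g) (by linarith) he
  have hK : ∀ j : Fin m, Integrable fun x => 2 * g * (multiDens g e x / (x 0 - x j.succ)) :=
    fun j => (integrable_multiDens_div hg.le he j).const_mul (2 * g)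
  have hS := integrable_finsetSum Finset.univ fun j _ => hK j
  have hD := (hA.sub hB).add hS
  -- Integrating by parts against the constant `1` says that the integral of the directional
  -- derivative is zero.
  have h := integral_bilinear_hasLineDerivAt_right_eq_neg_left_of_integrable
    (μ := (volume : Measure (Fin (m + 1) → ℝ))) (B := ContinuousLinearMap.mul ℝ ℝ)
    (f := multiDens g e) (g := fun _ => (1 : ℝ)) (g' := fun _ => 0) (v := Pi.single 0 1)
    (f' := fun x => (f 0 + 1) * multiDens g f x - multiDens g e x +
        ∑ j : Fin m, 2 * g * (multiDens g e x / (x 0 - x j.succ)))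
    (by simpa using! hD) (by simp) (by simpa using hB)
    (fun x _ => hasLineDerivAt_multiDens hg hf x)
    (fun x _ => hasDerivAt_const (0 : ℝ) (1 : ℝ))
  simp only [ContinuousLinearMap.mul_apply', mul_zero, integral_zero, mul_one] at h
  have h2 := integral_add (hA.sub hB) hS
  simp only [Pi.sub_apply] at h2
  rw [h2, integral_sub hA hB, integral_const_mul, integral_finsetSum _ fun j _ => hK j] at h
  simp only [integral_const_mul] at h
  unfold multiInt
  linarith

/-! ### Symmetrization and the Aomoto recursion. -/

lemma comp_swap_eq_self {α β : Type*} [DecidableEq α] {h : α → β} {p q : α} (hpq : h p = h q) :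
    h ∘ Equiv.swap p q = h := by
  ext i
  simp only [Function.comp_apply, Equiv.swap_apply_def]
  split_ifs with h1 h2
  · rw [h1, hpq]
  · rw [h2, hpq]
  · rfl

lemma multiDens_comp_perm_of_eq {m : ℕ} (g : ℝ) {e : Fin m → ℝ} {σ : Equiv.Perm (Fin m)}
    (he : e ∘ σ = e) (x : Fin m → ℝ) : multiDens g e (x ∘ σ) = multiDens g e x := by
  conv_lhs => rw [← he]
  exact multiDens_comp_perm g e x σ

lemma integral_eq_half_of_add_swap {m : ℕ} {φ ψ : (Fin m → ℝ) → ℝ} (hφ : Integrable φ)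
    (σ : Equiv.Perm (Fin m)) (h : ∀ x : Fin m → ℝ, Function.Injective x → φ x + φ (x ∘ σ) = ψ x) :
    ∫ x, φ x = (∫ x, ψ x) / 2 := by
  have h1 : ∫ x, ψ x = ∫ x, (φ x + φ (x ∘ σ)) := by
    refine integral_congr_ae ?_
    filter_upwards [ae_injective m] with x hx using (h x hx).symm
  have h2 : Integrable fun x => φ (x ∘ σ) :=
    ((measurePreserving_comp_perm σ).integrable_comp_emb
      (measurableEmbedding_comp_perm σ)).2 hφ
  rw [h1, integral_add hφ h2, integral_comp_perm σ φ]
  ring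

/-- The singular integrals produced by integration by parts, evaluated by symmetrization. -/
lemma integral_multiDens_div {m : ℕ} {g : ℝ} (hg : 1 / 2 ≤ g) {f : Fin (m + 1) → ℝ}
    (hf : 0 < f 0) (hf' : ∀ j, -1 < f j) (j : Fin m) {θ : ℝ}
    (hθ : (f j.succ = f 0 + 1 ∧ θ = 0) ∨ (f j.succ = f 0 ∧ θ = 1 / 2) ∨
      (f j.succ + 1 = f 0 ∧ θ = 1)) :
    ∫ x, multiDens g (Function.update f 0 (f 0 + 1)) x / (x 0 - x j.succ) =
      θ * multiInt g f := by
  have he : ∀ j, -1 < Function.update f 0 (f 0 + 1) j := by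
    intro j
    by_cases hj : j = 0
    · subst hj; simp; linarith
    · rw [Function.update_of_ne hj]; exact hf' j
  have hint := integrable_multiDens_div hg he j
  have hup : Function.update f 0 (f 0 + 1) j.succ = f j.succ :=
    Function.update_of_ne (Fin.succ_ne_zero j) _ _
  have hne : ∀ {x : Fin (m + 1) → ℝ}, Function.Injective x → x 0 - x j.succ ≠ 0 := fun hx h =>
    (Fin.succ_ne_zero j) (hx (sub_eq_zero.1 h)).symm
  have hne' : ∀ {x : Fin (m + 1) → ℝ}, Function.Injective x → x j.succ - x 0 ≠ 0 := fun hx h =>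
    (Fin.succ_ne_zero j) (hx (sub_eq_zero.1 h))
  have hsw0 : ∀ x : Fin (m + 1) → ℝ, (x ∘ Equiv.swap 0 j.succ) 0 = x j.succ := fun x => by simp
  have hswj : ∀ x : Fin (m + 1) → ℝ, (x ∘ Equiv.swap 0 j.succ) j.succ = x 0 := fun x => by simp
  -- Write `u = x 0`, `v = x j.succ`. Up to a factor symmetric in `u, v`, the numerator is `1`, `u`
  -- or `u ^ 2` respectively. Adding the swapped term gives `1/(u-v) + 1/(v-u) = 0`, `u/(u-v) +
  -- v/(v-u) = 1` and `u²/(u-v) + v²/(v-u) = u + v`.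
  rcases hθ with ⟨h, rfl⟩ | ⟨h, rfl⟩ | ⟨h, rfl⟩
  · rw [integral_eq_half_of_add_swap hint (Equiv.swap 0 j.succ) (ψ := fun _ => 0)]
    · simp
    · intro x hx
      rw [multiDens_comp_perm_of_eq g (comp_swap_eq_self (by rw [hup, h]; simp)), hsw0, hswj]
      have h1 := hne hx
      have h2 := hne' hx
      field_simp
      ring
  · rw [integral_eq_half_of_add_swap hint (Equiv.swap 0 j.succ) (ψ := multiDens g f), multiInt]
    · ring
    · intro x hx
      rw [multiDens_update_add_one, multiDens_update_add_one,
        multiDens_comp_perm_of_eq g (comp_swap_eq_self h.symm), hsw0, hswj]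
      have h1 := hne hx
      have h2 := hne' hx
      field_simp
      ring
  · rw [integral_eq_half_of_add_swap hint (Equiv.swap 0 j.succ)
      (ψ := fun x => multiDens g f x + multiDens g f (x ∘ Equiv.swap 0 j.succ))]
    · have hi := integrable_multiDens (g := g) (by linarith) hf'
      have hi' : Integrable fun x => multiDens g f (x ∘ Equiv.swap 0 j.succ) :=
        ((measurePreserving_comp_perm _).integrable_comp_emb
          (measurableEmbedding_comp_perm _)).2 hi
      rw [integral_add hi hi', integral_comp_perm _ (multiDens g f), multiInt]
      ring
    · intro x hx
      -- Lowering the exponent at `0` by one yields exponents `k` that agree at `0` and `j.succ`, so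
      -- their density is the symmetric factor.
      obtain ⟨k, hk, hkk⟩ : ∃ k : Fin (m + 1) → ℝ, f = Function.update k 0 (k 0 + 1) ∧
          k 0 = k j.succ := by
        refine ⟨Function.update f 0 (f j.succ), ?_, ?_⟩
        · ext i
          by_cases hi : i = 0
          · subst hi; simp [h]
          · simp [Function.update_of_ne hi]
        · simp
      have hD : ∀ y, multiDens g f y = y 0 * multiDens g k y := fun y => by
        rw [hk, multiDens_update_add_one]
      rw [multiDens_update_add_one, multiDens_update_add_one, hD, hD,
        multiDens_comp_perm_of_eq g (comp_swap_eq_self hkk), hsw0, hswj]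
      have h1 := hne hx
      have h2 := hne' hx
      field_simp
      ring

/-- The Aomoto recursion: raising one exponent by one. -/
theorem multiInt_update_add_one {m : ℕ} {g : ℝ} (hg : 1 / 2 < g) {f : Fin m → ℝ} (p : Fin m)
    (hf : 0 < f p) (hf' : ∀ j, -1 < f j) (θ : Fin m → ℝ)
    (hθ : ∀ q, q ≠ p → (f q = f p + 1 ∧ θ q = 0) ∨ (f q = f p ∧ θ q = 1 / 2) ∨
      (f q + 1 = f p ∧ θ q = 1)) :
    multiInt g (Function.update f p (f p + 1)) =
      (f p + 1 + 2 * g * ∑ q ∈ Finset.univ.erase p, θ q) * multiInt g f := by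
  obtain ⟨M, rfl⟩ : ∃ M, m = M + 1 := ⟨m - 1, by have := p.pos; omega⟩
  set σ := Equiv.swap 0 p with hσ
  have hσ0 : σ 0 = p := Equiv.swap_apply_left _ _
  have h1 : Function.update f p (f p + 1) ∘ σ =
      Function.update (f ∘ σ) 0 ((f ∘ σ) 0 + 1) := by
    ext i
    simp only [Function.comp_apply, Function.update_apply, hσ0]
    have : σ i = p ↔ i = 0 := by rw [← hσ0]; exact σ.injective.eq_iff
    simp [this]
  have h2 : ∑ q ∈ Finset.univ.erase p, θ q = ∑ j : Fin M, θ (σ j.succ) := by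
    have h3 := Finset.add_sum_erase Finset.univ θ (Finset.mem_univ p)
    have h4 := Equiv.sum_comp σ θ
    rw [Fin.sum_univ_succ, hσ0] at h4
    linarith
  rw [← multiInt_comp_perm g _ σ, h1, multiInt_integration_by_parts hg (f := f ∘ σ)
    (by simpa [hσ0] using hf) (fun j => hf' _)]
  rw [Finset.sum_congr rfl fun j _ => by
    rw [integral_multiDens_div hg.le (f := f ∘ σ) (by simpa [hσ0] using hf) (fun j => hf' _) j
      (θ := θ (σ j.succ)) (by
        simp only [Function.comp_apply, hσ0]
        exact hθ _ fun h => Fin.succ_ne_zero j (σ.injective (h.trans hσ0.symm)))]]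
  rw [multiInt_comp_perm, h2, ← Finset.mul_sum, ← Finset.sum_mul]
  simp only [Function.comp_apply, hσ0]
  ring

/-! ### Iterating the recursion to obtain the rising factorials. -/

/-- Exponents of the integrand with two overlapping products of initial coordinates. -/
def shape (m : ℕ) (a : ℝ) (k l : ℕ) (i : Fin m) : ℝ :=
  a - 1 + (if i.val < k then 1 else 0) + (if i.val < l then 1 else 0)

lemma sum_ite_val_lt {m k : ℕ} (hk : k ≤ m) :
    ∑ q : Fin m, (if q.val < k then (1 : ℝ) else 0) = k := by
  rw [Fin.sum_univ_eq_sum_range (fun q => if q < k then (1 : ℝ) else 0) m, Finset.sum_boole]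
  congr 1
  rw [show (Finset.range m).filter (· < k) = Finset.range k by ext; simp; omega,
    Finset.card_range]

lemma sum_erase_weights {m k l : ℕ} (hk : k < m) (hl : l ≤ m) {v : ℝ}
    (hv : 1 - (if (⟨k, hk⟩ : Fin m).val < k then (1 : ℝ) else 0) / 2 -
      (if (⟨k, hk⟩ : Fin m).val < l then (1 : ℝ) else 0) / 2 = v) :
    ∑ q ∈ Finset.univ.erase (⟨k, hk⟩ : Fin m),
      (1 - (if q.val < k then (1 : ℝ) else 0) / 2 - (if q.val < l then (1 : ℝ) else 0) / 2) =
      m - k / 2 - l / 2 - v := by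
  have h : ∑ q : Fin m, (1 - (if q.val < k then (1 : ℝ) else 0) / 2 -
      (if q.val < l then (1 : ℝ) else 0) / 2) = m - k / 2 - l / 2 := by
    rw [Finset.sum_sub_distrib, Finset.sum_sub_distrib, ← Finset.sum_div, ← Finset.sum_div,
      sum_ite_val_lt hk.le, sum_ite_val_lt hl]
    simp
  rw [← Finset.add_sum_erase Finset.univ _ (Finset.mem_univ (⟨k, hk⟩ : Fin m)), hv] at h
  linarith

/-- The exponent at `k` is `a`. Positions before `k` have `a + 1` (weight `0`), those between `k`
and `l` have `a` (weight `1/2`), those from `l` on have `a - 1` (weight `1`). The single formula `1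
- [q < k]/2 - [q < l]/2` covers all three. -/
lemma multiInt_shape_succ_left {m k l : ℕ} (hkl : k < l) (hl : l ≤ m) {a g : ℝ} (ha : 1 < a)
    (hg : 1 / 2 < g) :
    multiInt g (shape m a (k + 1) l) =
      (1 + a + (2 * m - l - (k + 1)) * g) * multiInt g (shape m a k l) := by
  have hk : k < m := by omega
  have hfp : shape m a k l ⟨k, hk⟩ = a := by simp [shape, hkl]
  have h1 : shape m a (k + 1) l =
      Function.update (shape m a k l) ⟨k, hk⟩ (shape m a k l ⟨k, hk⟩ + 1) := by
    ext i
    rw [Function.update_apply, hfp]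
    by_cases hi : i = ⟨k, hk⟩
    · subst hi; simp [shape, hkl]
    · have : i.val ≠ k := fun h => hi (Fin.ext h)
      rw [if_neg hi]
      simp only [shape]
      congr 3
      exact propext ⟨fun h => by omega, fun h => by omega⟩
  rw [h1, multiInt_update_add_one hg ⟨k, hk⟩ (by rw [hfp]; linarith) (fun j => ?_)
    (fun q => 1 - (if q.val < k then (1 : ℝ) else 0) / 2 -
      (if q.val < l then (1 : ℝ) else 0) / 2) (fun q hq => ?_),
    sum_erase_weights hk hl (v := 1 / 2) (by simp [hkl]; norm_num), hfp]
  · ring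
  · simp only [shape]; split_ifs <;> linarith
  · rw [hfp]
    simp only [shape]
    by_cases hqk : q.val < k
    · simp [hqk, hqk.trans hkl]; norm_num
    · by_cases hql : q.val < l
      · simp [hqk, hql]; norm_num
      · simp [hqk, hql]

lemma multiInt_shape_zero_succ {m l : ℕ} (hl : l < m) {a g : ℝ} (ha : 1 < a) (hg : 1 / 2 < g) :
    multiInt g (shape m a 0 (l + 1)) =
      (a + (m - (l + 1)) * g) * multiInt g (shape m a 0 l) := by
  have hfp : shape m a 0 l ⟨l, hl⟩ = a - 1 := by simp [shape]
  have h1 : shape m a 0 (l + 1) =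
      Function.update (shape m a 0 l) ⟨l, hl⟩ (shape m a 0 l ⟨l, hl⟩ + 1) := by
    ext i
    rw [Function.update_apply, hfp]
    by_cases hi : i = ⟨l, hl⟩
    · subst hi; simp [shape]
    · have : i.val ≠ l := fun h => hi (Fin.ext h)
      rw [if_neg hi]
      simp only [shape]
      congr 2
      exact propext ⟨fun h => by omega, fun h => by omega⟩
  rw [h1, multiInt_update_add_one hg ⟨l, hl⟩ (by rw [hfp]; linarith) (fun j => ?_)
    (fun q => 1 / 2 * (1 - (if q.val < l then (1 : ℝ) else 0) / 2 -
      (if q.val < l then (1 : ℝ) else 0) / 2)) (fun q hq => ?_), ← Finset.mul_sum,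
    sum_erase_weights hl hl.le (v := 1) (by simp), hfp]
  · ring
  · simp only [shape]; split_ifs <;> linarith
  · rw [hfp]
    simp only [shape]
    by_cases hql : q.val < l
    · simp [hql]; norm_num
    · simp [hql]

theorem multiInt_shape {m k l : ℕ} (hkl : k ≤ l) (hl : l ≤ m) {a g : ℝ} (ha : 1 < a)
    (hg : 1 / 2 < g) :
    multiInt g (shape m a k l) =
      (∏ i ∈ Finset.range k, (1 + a + (2 * m - l - (i + 1)) * g)) *
      (∏ i ∈ Finset.range l, (a + (m - (i + 1)) * g)) * multiInt g (fun _ : Fin m => a - 1) := by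
  induction k with
  | zero =>
    induction l with
    | zero =>
      have : shape m a 0 0 = fun _ => a - 1 := by ext; simp [shape]
      simp [this]
    | succ l ih =>
      have := ih (by omega) (Nat.zero_le _)
      rw [multiInt_shape_zero_succ (by omega) ha hg, this, Finset.prod_range_succ]
      simp
      ring
  | succ k ih =>
    rw [multiInt_shape_succ_left (by omega) hl ha hg, ih (by omega), Finset.prod_range_succ]
    ring

/-- The case `k = 0`, `l = m` raises every exponent, so the recursion becomes a functional equation
in `a`. -/
theorem multiInt_const_add_one (m : ℕ) {a g : ℝ} (ha : 1 < a) (hg : 1 / 2 < g) :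
    multiInt g (fun _ : Fin m => a + 1 - 1) =
      (∏ j ∈ Finset.range m, (a + j * g)) * multiInt g (fun _ : Fin m => a - 1) := by
  have h := multiInt_shape (Nat.zero_le m) le_rfl ha hg
  have h1 : shape m a 0 m = fun _ => a + 1 - 1 := by ext; simp [shape]
  rw [h1] at h
  rw [h, Finset.prod_range_zero, one_mul, ← Finset.prod_range_reflect]
  congr 1
  refine Finset.prod_congr rfl fun i hi => ?_
  have : i < m := Finset.mem_range.1 hi
  rw [Nat.sub_sub, Nat.cast_sub (by omega)]
  push_cast
  ring

/-! ### Log-convexity and the Bohr–Mollerup argument. -/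

lemma multiDens_nonneg {m : ℕ} (g : ℝ) (e x : Fin m → ℝ) : 0 ≤ multiDens g e x :=
  mul_nonneg (Real.rpow_nonneg (abs_nonneg _) _)
    (Finset.prod_nonneg fun _ _ => gammaWeight_nonneg _ _ _)

lemma multiDens_const_eq_indicator {m : ℕ} (g a : ℝ) :
    multiDens g (fun _ : Fin m => a - 1) = (posOrthant m).indicator (dens a g 1) := by
  ext x
  by_cases hx : x ∈ posOrthant m
  · rw [indicator_of_mem hx, multiDens, dens]
    congr 1
    exact Finset.prod_congr rfl fun j _ => gammaWeight_of_pos _ _ (hx j)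
  · obtain ⟨i, hi⟩ : ∃ i, x i ≤ 0 := by simpa [posOrthant] using hx
    rw [indicator_of_notMem hx, multiDens,
      Finset.prod_eq_zero (Finset.mem_univ i) (gammaWeight_of_nonpos _ _ hi), mul_zero]

lemma isOpen_posOrthant (m : ℕ) : IsOpen (posOrthant m) := by
  have : posOrthant m = ⋂ i, {x | 0 < x i} := by ext; simp [posOrthant]
  rw [this]
  exact isOpen_iInter_of_finite fun i => isOpen_lt continuous_const (continuous_apply i)

lemma volume_posOrthant_pos (m : ℕ) : 0 < volume (posOrthant m) :=
  (isOpen_posOrthant m).measure_pos _ ⟨fun _ => 1, fun _ => one_pos⟩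

lemma multiInt_const_pos (m : ℕ) {g a : ℝ} (hg : 0 ≤ g) (ha : 0 < a) :
    0 < multiInt g (fun _ : Fin m => a - 1) := by
  have hint := integrable_multiDens hg (e := fun _ : Fin m => a - 1) fun _ => by linarith
  rw [multiInt, integral_pos_iff_support_of_nonneg (multiDens_nonneg g _) hint]
  refine (volume_posOrthant_pos m).trans_le (measure_mono_ae ?_)
  filter_upwards [ae_injective m] with x hx hpos
  refine (mul_pos (Real.rpow_pos_of_pos (abs_vdm_pos hx) _) (Finset.prod_pos fun j _ => ?_)).ne'
  have hj : 0 < x j := hpos j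
  rw [gammaWeight_of_pos _ _ hj]
  positivity

lemma gammaWeight_convexComb {s t : ℝ} (hs : 0 < s) (hst : s + t = 1) (a b u : ℝ) :
    gammaWeight 1 (s * a + t * b - 1) u = gammaWeight 1 (a - 1) u ^ s * gammaWeight 1 (b - 1) u ^ t := by
  rcases lt_or_ge 0 u with hu | hu
  · rw [gammaWeight_of_pos _ _ hu, gammaWeight_of_pos _ _ hu, gammaWeight_of_pos _ _ hu,
      Real.mul_rpow (by positivity) (by positivity), Real.mul_rpow (by positivity) (by positivity),
      ← Real.rpow_mul hu.le, ← Real.rpow_mul hu.le, ← Real.exp_mul, ← Real.exp_mul,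
      show s * a + t * b - 1 = (a - 1) * s + (b - 1) * t by linear_combination hst,
      Real.rpow_add hu, show -1 * u = -1 * u * s + -1 * u * t by linear_combination u * hst,
      Real.exp_add]
    simp only [neg_mul, one_mul, ← neg_add, ← mul_add, hst, mul_one]
    ring
  · rw [gammaWeight_of_nonpos _ _ hu, gammaWeight_of_nonpos _ _ hu, Real.zero_rpow hs.ne', zero_mul]

lemma multiDens_convexComb {m : ℕ} {g : ℝ} {s t : ℝ} (hs : 0 < s)
    (hst : s + t = 1) (a b : ℝ) (x : Fin m → ℝ) :
    multiDens g (fun _ => s * a + t * b - 1) x =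
      multiDens g (fun _ => a - 1) x ^ s * multiDens g (fun _ => b - 1) x ^ t := by
  have hP : ∀ e : ℝ, 0 ≤ ∏ j, gammaWeight 1 e (x j) := fun e =>
    Finset.prod_nonneg fun j _ => gammaWeight_nonneg _ _ _
  have hV : 0 ≤ |vdm x| ^ (2 * g) := by positivity
  simp only [multiDens]
  rw [Real.mul_rpow hV (hP _), Real.mul_rpow hV (hP _),
    ← Real.finsetProd_rpow _ _ fun j _ => gammaWeight_nonneg _ _ _,
    ← Real.finsetProd_rpow _ _ fun j _ => gammaWeight_nonneg _ _ _]
  simp only [gammaWeight_convexComb hs hst, Finset.prod_mul_distrib]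
  have : (|vdm x| ^ (2 * g)) ^ s * (|vdm x| ^ (2 * g)) ^ t = |vdm x| ^ (2 * g) := by
    rcases hV.eq_or_lt with h0 | h0
    · rw [← h0, Real.zero_rpow hs.ne', zero_mul]
    · rw [← Real.rpow_add h0, hst, Real.rpow_one]
  calc _ = ((|vdm x| ^ (2 * g)) ^ s * (|vdm x| ^ (2 * g)) ^ t) * _ := by rw [this]
    _ = _ := by ring

/-- The density is pointwise log-affine in `a`, so this is Hölder's inequality. -/
lemma multiInt_convexComb_le (m : ℕ) {g : ℝ} (hg : 0 ≤ g) {s t : ℝ} (hs : 0 < s) (ht : 0 < t)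
    (hst : s + t = 1) {a b : ℝ} (ha : 0 < a) (hb : 0 < b) :
    multiInt g (fun _ : Fin m => s * a + t * b - 1) ≤
      multiInt g (fun _ : Fin m => a - 1) ^ s * multiInt g (fun _ : Fin m => b - 1) ^ t := by
  have hab : 0 < s * a + t * b := by positivity
  have hI : ∀ c : ℝ, 0 < c → ENNReal.ofReal (multiInt g (fun _ : Fin m => c - 1)) =
      ∫⁻ x, ENNReal.ofReal (multiDens g (fun _ : Fin m => c - 1) x) := fun c hc =>
    ofReal_integral_eq_lintegral_ofReal (integrable_multiDens hg fun _ => by linarith)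
      (Filter.Eventually.of_forall fun x => multiDens_nonneg g _ x)
  have hpa := multiInt_const_pos m hg ha
  have hpb := multiInt_const_pos m hg hb
  rw [← ENNReal.ofReal_le_ofReal_iff (by positivity), ENNReal.ofReal_mul (by positivity),
    ← ENNReal.ofReal_rpow_of_nonneg hpa.le hs.le, ← ENNReal.ofReal_rpow_of_nonneg hpb.le ht.le,
    hI _ hab, hI _ ha, hI _ hb]
  refine le_trans (le_of_eq ?_) (ENNReal.lintegral_mul_norm_pow_le
    (measurable_multiDens g _).ennreal_ofReal.aemeasurable
    (measurable_multiDens g _).ennreal_ofReal.aemeasurable hs.le ht.le hst)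
  refine lintegral_congr fun x => ?_
  rw [multiDens_convexComb hs hst, ENNReal.ofReal_mul (Real.rpow_nonneg (multiDens_nonneg _ _ _) _),
    ENNReal.ofReal_rpow_of_nonneg (multiDens_nonneg _ _ _) hs.le,
    ENNReal.ofReal_rpow_of_nonneg (multiDens_nonneg _ _ _) ht.le]

lemma convexOn_log_multiInt (m : ℕ) {g : ℝ} (hg : 0 ≤ g) :
    ConvexOn ℝ (Ioi 0) fun a => Real.log (multiInt g (fun _ : Fin m => a - 1)) := by
  refine convexOn_iff_forall_pos.2 ⟨convex_Ioi 0, fun a ha b hb s t hs ht hst => ?_⟩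
  have ha : 0 < a := ha
  have hb : 0 < b := hb
  have hpa := multiInt_const_pos m hg ha
  have hpb := multiInt_const_pos m hg hb
  simp only [smul_eq_mul]
  rw [← Real.log_rpow hpa, ← Real.log_rpow hpb, ← Real.log_mul (by positivity) (by positivity)]
  exact Real.log_le_log (multiInt_const_pos m hg (by positivity))
    (multiInt_convexComb_le m hg hs ht hst ha hb)

/-- The increment of a convex function over `[x, x + t]` with `t ≤ 1`. -/
lemma ConvexOn.increment_bounds {c : ℝ} {F q : ℝ → ℝ} (hF : ConvexOn ℝ (Ioi c) F)
    (hq : ∀ x, c < x → F (x + 1) = F x + q x) {x t : ℝ} (hx : c < x) (ht : 0 < t) (ht1 : t ≤ 1) :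
    t * q x ≤ F (x + 1 + t) - F (x + 1) ∧ F (x + 1 + t) - F (x + 1) ≤ t * q (x + 1) := by
  constructor
  · have h := hF.slope_mono_adjacent (x := x) (y := x + 1) (z := x + 1 + t) hx
      (mem_Ioi.2 (by linarith)) (by linarith) (by linarith)
    rw [show x + 1 - x = 1 by ring, show x + 1 + t - (x + 1) = t by ring,
      le_div_iff₀ ht, show F (x + 1) - F x = q x by rw [hq x hx]; ring] at h
    linarith
  · have h := hF.secant_mono (a := x + 1) (x := x + 1 + t) (y := x + 1 + 1) (mem_Ioi.2 (by linarith))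
      (mem_Ioi.2 (by linarith)) (mem_Ioi.2 (by linarith)) (by linarith) (by linarith) (by linarith)
    rw [hq (x + 1) (by linarith), show x + 1 + 1 - (x + 1) = 1 by ring,
      show x + 1 + t - (x + 1) = t by ring, div_le_iff₀ ht] at h
    linarith

/-- A uniqueness principle in the style of Bohr and Mollerup. -/
theorem ConvexOn.sub_eq_of_functional_equation {c : ℝ} {F G q : ℝ → ℝ}
    (hF : ConvexOn ℝ (Ioi c) F) (hG : ConvexOn ℝ (Ioi c) G)
    (hFq : ∀ x, c < x → F (x + 1) = F x + q x) (hGq : ∀ x, c < x → G (x + 1) = G x + q x)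
    (hq : Filter.Tendsto (fun x => q (x + 1) - q x) Filter.atTop (nhds 0))
    {x y : ℝ} (hx : c < x) (hy : c < y) : F x - G x = F y - G y := by
  have hper : ∀ (n : ℕ) (x : ℝ), c < x → F (x + n) - G (x + n) = F x - G x := by
    intro n x hx
    induction n with
    | zero => simp
    | succ n ih =>
      have hn : c < x + n := by have : (0 : ℝ) ≤ n := n.cast_nonneg; linarith
      have h1 := hFq _ hn
      have h2 := hGq _ hn
      push_cast
      rw [← add_assoc]
      linarith
  have hstep : ∀ x t : ℝ, c < x → 0 < t → t ≤ 1 → F (x + t) - G (x + t) = F x - G x := by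
    intro x t hx ht ht1
    have hlim : Filter.Tendsto (fun n : ℕ => q (x + n + 1) - q (x + n)) Filter.atTop (nhds 0) :=
      hq.comp (Filter.tendsto_atTop_add_const_left _ x tendsto_natCast_atTop_atTop)
    -- `F - G` is 1-periodic, so the comparison can be moved out to `x + n + 1`. There both
    -- increments lie in `[t * q (x + n), t * q (x + n + 1)]`, whose length tends to `0`.
    have hle : ∀ n : ℕ, |F (x + t) - G (x + t) - (F x - G x)| ≤ q (x + n + 1) - q (x + n) := by
      intro n
      have hn : c < x + n := by have : (0 : ℝ) ≤ n := n.cast_nonneg; linarith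
      obtain ⟨h1, h2⟩ := ConvexOn.increment_bounds hF hFq hn ht ht1
      obtain ⟨h3, h4⟩ := ConvexOn.increment_bounds hG hGq hn ht ht1
      have h5 := hper (n + 1) x hx
      have h6 := hper (n + 1) (x + t) (by linarith)
      push_cast at h5 h6
      rw [show x + ((n : ℝ) + 1) = x + n + 1 by ring] at h5
      rw [show x + t + ((n : ℝ) + 1) = x + n + 1 + t by ring] at h6
      rw [abs_le]
      constructor <;> nlinarith
    have := ge_of_tendsto' hlim hle
    have := abs_nonpos_iff.1 this
    linarith
  wlog hxy : x ≤ y generalizing x y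
  · exact (this hy hx (le_of_not_ge hxy)).symm
  have h0 := Nat.floor_le (sub_nonneg.2 hxy)
  have h1 := Nat.lt_floor_add_one (y - x)
  have h2 := hper ⌊y - x⌋₊ x hx
  rcases h0.eq_or_lt with h | h
  · rw [h, add_sub_cancel] at h2; exact h2.symm
  · have := hstep (x + ⌊y - x⌋₊) (y - x - ⌊y - x⌋₊)
      (by have : (0 : ℝ) ≤ ⌊y - x⌋₊ := Nat.cast_nonneg _; linarith) (by linarith) (by linarith)
    rw [show x + ⌊y - x⌋₊ + (y - x - ⌊y - x⌋₊) = y by ring] at this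
    linarith

lemma convexOn_sum_log_Gamma (m : ℕ) {g : ℝ} (hg : 0 ≤ g) :
    ConvexOn ℝ (Ioi 0) fun a => ∑ j ∈ Finset.range m, Real.log (Real.Gamma (a + j * g)) := by
  have h : ∀ j : ℕ, ConvexOn ℝ (Ioi 0) fun a => Real.log (Real.Gamma (a + j * g)) := by
    intro j
    have h1 := Real.convexOn_log_Gamma.translate_left (j * g)
    refine h1.subset (fun a ha => ?_) (convex_Ioi 0)
    have : 0 < a := ha
    simp only [mem_preimage, mem_Ioi]
    positivity
  induction m with
  | zero => simpa using convexOn_const (0 : ℝ) (convex_Ioi (0 : ℝ))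
  | succ m ih =>
    simp only [Finset.sum_range_succ]
    exact ih.add (h m)

/-- Up to a factor independent of `x`, the Selberg integral is a product of Gamma values. -/
theorem multiInt_mul_prod_Gamma (m : ℕ) {g x y : ℝ} (hg : 1 / 2 < g) (hx : 1 < x) (hy : 1 < y) :
    multiInt g (fun _ : Fin m => x - 1) * ∏ j ∈ Finset.range m, Real.Gamma (y + j * g) =
      multiInt g (fun _ : Fin m => y - 1) * ∏ j ∈ Finset.range m, Real.Gamma (x + j * g) := by
  have hg0 : 0 ≤ g := by linarith
  have hsub : Ioi (1 : ℝ) ⊆ Ioi 0 := Ioi_subset_Ioi zero_le_one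
  have hpos : ∀ a : ℝ, 1 < a → ∀ j : ℕ, 0 < a + j * g := fun a ha j => by
    have : 0 ≤ (j : ℝ) * g := by positivity
    linarith
  have key := ConvexOn.sub_eq_of_functional_equation (c := 1)
    (q := fun x => ∑ j ∈ Finset.range m, Real.log (x + j * g))
    ((convexOn_log_multiInt m hg0).subset hsub (convex_Ioi 1))
    ((convexOn_sum_log_Gamma m hg0).subset hsub (convex_Ioi 1)) ?_ ?_ ?_ hx hy
  · have hSx := multiInt_const_pos m hg0 (by linarith : 0 < x)
    have hSy := multiInt_const_pos m hg0 (by linarith : 0 < y)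
    have hG : ∀ a : ℝ, 1 < a → ∀ j ∈ Finset.range m, Real.Gamma (a + j * g) ≠ 0 :=
      fun a ha j _ => (Real.Gamma_pos_of_pos (hpos a ha j)).ne'
    have hGp : ∀ a : ℝ, 1 < a → 0 < ∏ j ∈ Finset.range m, Real.Gamma (a + j * g) :=
      fun a ha => Finset.prod_pos fun j _ => Real.Gamma_pos_of_pos (hpos a ha j)
    rw [← Real.log_prod (hG x hx), ← Real.log_prod (hG y hy)] at key
    have h1 := hGp x hx
    have h2 := hGp y hy
    refine Real.log_injOn_pos (mem_Ioi.2 (by positivity)) (mem_Ioi.2 (by positivity)) ?_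
    rw [Real.log_mul hSx.ne' h2.ne', Real.log_mul hSy.ne' h1.ne']
    linarith
  · intro a ha
    rw [multiInt_const_add_one m ha hg, Real.log_mul
      (Finset.prod_ne_zero_iff.2 fun j _ => (hpos a ha j).ne')
      (multiInt_const_pos m hg0 (by linarith)).ne',
      Real.log_prod fun j _ => (hpos a ha j).ne']
    ring
  · intro a ha
    rw [← Finset.sum_add_distrib]
    refine Finset.sum_congr rfl fun j _ => ?_
    have h := hpos a ha j
    rw [show a + 1 + j * g = a + j * g + 1 by ring, Real.Gamma_add_one h.ne',
      Real.log_mul h.ne' (Real.Gamma_pos_of_pos h).ne']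
    ring
  · simp only [← Finset.sum_sub_distrib]
    rw [← Finset.sum_const_zero (s := Finset.range m)]
    refine tendsto_finsetSum _ fun j _ => ?_
    have h := (Real.tendsto_log_comp_add_sub_log 1).comp
      (Filter.tendsto_atTop_add_const_right _ (j * g) Filter.tendsto_id)
    refine h.congr fun x => ?_
    simp only [Function.comp_apply, id]
    ring_nf

/-! ### Normalization at `a = 1` and evaluation of the Selberg integral. -/

lemma continuousAt_multiInt (m : ℕ) {g a : ℝ} (hg : 0 ≤ g) (ha : 0 < a) :
    ContinuousAt (fun a => multiInt g (fun _ : Fin m => a - 1)) a := by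
  have h := ((convexOn_log_multiInt m hg).continuousOn isOpen_Ioi).continuousAt (Ioi_mem_nhds ha)
  refine (h.rexp).congr ?_
  filter_upwards [Ioi_mem_nhds ha] with b hb using Real.exp_log (multiInt_const_pos m hg hb)

/-- The recursion is available only for `x > 1`; the endpoint `x = 1`, where the dimension drops, is
reached by continuity. -/
theorem multiInt_mul_prod_Gamma_one (m : ℕ) {g y : ℝ} (hg : 1 / 2 < g) (hy : 1 < y) :
    multiInt g (fun _ : Fin m => 1 - 1) * ∏ j ∈ Finset.range m, Real.Gamma (y + j * g) =
      multiInt g (fun _ : Fin m => y - 1) * ∏ j ∈ Finset.range m, Real.Gamma (1 + j * g) := by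
  have hc1 : ContinuousAt (fun x => multiInt g (fun _ : Fin m => x - 1) *
      ∏ j ∈ Finset.range m, Real.Gamma (y + j * g)) 1 :=
    (continuousAt_multiInt m (by linarith) one_pos).mul continuousAt_const
  have hc2 : ContinuousAt (fun x => multiInt g (fun _ : Fin m => y - 1) *
      ∏ j ∈ Finset.range m, Real.Gamma (x + j * g)) 1 := by
    refine continuousAt_const.mul (tendsto_finsetProd _ fun j _ => ?_)
    have hj : (0 : ℝ) < 1 + j * g := by
      have : 0 ≤ (j : ℝ) * g := by have : 0 < g := by linarith
                                   positivity
      linarith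
    have h1 : ContinuousAt Real.Gamma (1 + j * g) :=
      (Real.differentiableAt_Gamma fun n => by
        have : (0 : ℝ) ≤ n := n.cast_nonneg
        linarith).continuousAt
    exact ContinuousAt.comp (f := fun x : ℝ => x + j * g) h1 (by fun_prop)
  refine tendsto_nhds_unique_of_eventuallyEq
    (hc1.tendsto.mono_left (nhdsWithin_le_nhds (s := Ioi 1)))
    (hc2.tendsto.mono_left (nhdsWithin_le_nhds (s := Ioi 1))) ?_
  filter_upwards [self_mem_nhdsWithin] with x hx using multiInt_mul_prod_Gamma m hg hx hy

lemma ofReal_multiInt_const {m : ℕ} {g a : ℝ} (hg : 0 ≤ g) (ha : 0 < a) :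
    ENNReal.ofReal (multiInt g (fun _ : Fin m => a - 1)) =
      ∫⁻ x in posOrthant m, ENNReal.ofReal (dens a g 1 x) := by
  rw [multiInt, ofReal_integral_eq_lintegral_ofReal (integrable_multiDens hg fun _ => by linarith)
    (Filter.Eventually.of_forall fun x => multiDens_nonneg g _ x),
    ← lintegral_indicator (measurableSet_posOrthant m)]
  refine lintegral_congr fun x => ?_
  rw [multiDens_const_eq_indicator]
  by_cases hx : x ∈ posOrthant m <;> simp [hx]

/-- For `a = 1`, splitting off the smallest variable lowers the dimension. -/
theorem multiInt_one_succ (m : ℕ) {g : ℝ} (hg : 0 ≤ g) :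
    multiInt g (fun _ : Fin (m + 1) => 1 - 1) = multiInt g (fun _ : Fin m => 1 + 2 * g - 1) := by
  rw [← ENNReal.ofReal_eq_ofReal_iff (multiInt_const_pos _ hg one_pos).le
    (multiInt_const_pos m hg (by linarith)).le, ofReal_multiInt_const hg one_pos,
    ofReal_multiInt_const hg (by linarith), lintegral_posOrthant_succ _
    (measurable_dens 1 g 1).ennreal_ofReal (fun σ x => by rw [dens_comp_perm])]
  -- At `a = 1` the factors `(t + y_j) ^ (a - 1)` disappear, so `t` decouples. Its integral `1 / (m
  -- + 1)` cancels the number of positions of the minimum.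
  have h1 : ∀ t ∈ Ioi (0 : ℝ), ∫⁻ y in posOrthant m,
      ENNReal.ofReal (dens 1 g 1 (Fin.cons t fun j => t + y j : Fin (m + 1) → ℝ)) =
      ENNReal.ofReal (Real.exp (-(m + 1) * t)) *
        ∫⁻ y in posOrthant m, ENNReal.ofReal (dens (1 + 2 * g) g 1 y) := by
    intro t _
    rw [← lintegral_const_mul _ (measurable_dens _ _ _).ennreal_ofReal]
    refine setLIntegral_congr_fun (measurableSet_posOrthant m) fun y hy => ?_
    rw [dens_cons_add 1 g 1 t hy, ← ENNReal.ofReal_mul (Real.exp_pos _).le, dens]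
    congr 1
    simp
  rw [setLIntegral_congr_fun measurableSet_Ioi h1, lintegral_mul_const _ (by fun_prop), ← mul_assoc]
  have h2 : ∫⁻ t in Ioi (0 : ℝ), ENNReal.ofReal (Real.exp (-(m + 1) * t)) =
      ENNReal.ofReal (1 / (m + 1)) := by
    have hm : -((m : ℝ) + 1) < 0 := by have : (0 : ℝ) ≤ m := m.cast_nonneg; linarith
    rw [← ofReal_integral_eq_lintegral_ofReal (integrableOn_exp_mul_Ioi hm 0)
      (Filter.Eventually.of_forall fun t => (Real.exp_pos _).le), integral_exp_mul_Ioi hm]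
    congr 1
    rw [mul_zero, Real.exp_zero, neg_div_neg_eq]
  rw [h2, ← ENNReal.ofReal_natCast, ← ENNReal.ofReal_mul (by positivity)]
  have : ((m + 1 : ℕ) : ℝ) * (1 / (m + 1)) = 1 := by push_cast; field_simp
  rw [this, ENNReal.ofReal_one, one_mul]

/-- The exponential Selberg integral for large real parameters. -/
theorem multiInt_eq_prod_Gamma (m : ℕ) : ∀ {g a : ℝ}, 1 / 2 < g → 1 < a →
    multiInt g (fun _ : Fin m => a - 1) = ∏ j ∈ Finset.range m,
      (Real.Gamma (1 + g + j * g) * Real.Gamma (a + j * g) / Real.Gamma (1 + g)) := by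
  induction m with
  | zero =>
    intro g a hg ha
    simp [multiInt, multiDens, vdm, volume_pi, Measure.real]
  | succ m ih =>
    intro g a hg ha
    have hg0 : 0 < g := by linarith
    have hpos : ∀ j : ℕ, Real.Gamma (1 + j * g) ≠ 0 := fun j =>
      (Real.Gamma_pos_of_pos (by positivity)).ne'
    have h := multiInt_mul_prod_Gamma_one (m + 1) hg ha
    rw [multiInt_one_succ m hg0.le, ih hg (by linarith)] at h
    have hne : ∏ j ∈ Finset.range (m + 1), Real.Gamma (1 + j * g) ≠ 0 :=
      Finset.prod_ne_zero_iff.2 fun j _ => hpos j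
    rw [← mul_left_inj' hne, ← h]
    have hG1 : Real.Gamma (1 + g) ≠ 0 := by simpa using hpos 1
    -- Two index shifts match the Gamma products from the inductive value at `a = 1 + 2 * g` and
    -- from the comparison point `1` with those of the claim.
    have e1 : ∏ j ∈ Finset.range (m + 1), Real.Gamma (1 + g + j * g) =
        Real.Gamma (1 + g) * ∏ j ∈ Finset.range m, Real.Gamma (1 + 2 * g + j * g) := by
      rw [Finset.prod_range_succ', mul_comm]
      congr 1
      · simp
      · refine Finset.prod_congr rfl fun j _ => ?_
        push_cast; congr 1; ring
    have e2 : ∏ j ∈ Finset.range (m + 1), Real.Gamma (1 + j * g) =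
        ∏ j ∈ Finset.range m, Real.Gamma (1 + g + j * g) := by
      rw [Finset.prod_range_succ', Nat.cast_zero, zero_mul, add_zero, Real.Gamma_one, mul_one]
      refine Finset.prod_congr rfl fun j _ => ?_
      push_cast; congr 1; ring
    simp only [Finset.prod_div_distrib, Finset.prod_mul_distrib]
    rw [e1, e2]
    simp only [Finset.prod_const, Finset.card_range]
    rw [pow_succ]
    field_simp

/-! ### Domination and holomorphy in the complex parameters. -/

/-- A dominated parametric integral of holomorphic functions is holomorphic. -/
theorem differentiableOn_integral_of_dominated {X : Type*} [MeasurableSpace X] {μ : Measure X}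
    {U : Set ℂ} (hU : IsOpen U) {F : ℂ → X → ℂ} (hm : ∀ z, AEStronglyMeasurable (F z) μ)
    (hd : ∀ᵐ x ∂μ, DifferentiableOn ℂ (fun z => F z x) U)
    (hb : ∀ z₀ ∈ U, ∃ r > 0, ∃ bound : X → ℝ, Integrable bound μ ∧
      ∀ᵐ x ∂μ, ∀ z ∈ Metric.ball z₀ r, ‖F z x‖ ≤ bound x) :
    DifferentiableOn ℂ (fun z => ∫ x, F z x ∂μ) U := by
  intro z₀ hz₀
  obtain ⟨r₁, hr₁, bound, hbi, hbound⟩ := hb z₀ hz₀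
  obtain ⟨r₂, hr₂, hball⟩ := Metric.isOpen_iff.1 hU z₀ hz₀
  set r := min r₁ r₂ with hr
  have hr0 : 0 < r := lt_min hr₁ hr₂
  have hsub : Metric.ball z₀ r ⊆ U := (Metric.ball_subset_ball (min_le_right _ _)).trans hball
  have hsub₁ : Metric.ball z₀ r ⊆ Metric.ball z₀ r₁ := Metric.ball_subset_ball (min_le_left _ _)
  -- Since `r / 2 + r / 3 < r`, Cauchy's estimate on circles of radius `r / 3` bounds the derivative
  -- by the given bound for `F`.
  have hcb : ∀ z ∈ Metric.ball z₀ (r / 2), Metric.closedBall z (r / 3) ⊆ Metric.ball z₀ r := by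
    intro z hz w hw
    rw [Metric.mem_ball] at hz ⊢
    rw [Metric.mem_closedBall] at hw
    linarith [dist_triangle w z z₀]
  have hint : Integrable (F z₀) μ :=
    hbi.mono' (hm z₀) (hbound.mono fun x hx => hx z₀ (Metric.mem_ball_self hr₁))
  have hderiv : ∀ᵐ x ∂μ, ∀ z ∈ Metric.ball z₀ (r / 2),
      HasDerivAt (fun z => F z x) (deriv (fun z => F z x) z) z := by
    filter_upwards [hd] with x hx z hz
    refine (hx.differentiableAt (hU.mem_nhds (hsub ?_))).hasDerivAt
    exact hcb z hz (Metric.mem_closedBall_self (by positivity))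
  have hmeas : AEStronglyMeasurable (fun x => deriv (fun z => F z x) z₀) μ := by
    refine aestronglyMeasurable_of_tendsto_ae (nhdsWithin (0 : ℂ) {0}ᶜ)
      (f := fun t x => t⁻¹ • (F (z₀ + t) x - F z₀ x)) (fun t => ((hm _).fun_sub (hm _)).fun_const_smul _) ?_
    filter_upwards [hderiv] with x hx
    exact (hx z₀ (Metric.mem_ball_self (by positivity))).tendsto_slope_zero
  refine (hasDerivAt_integral_of_dominated_loc_of_deriv_le
    (Metric.ball_mem_nhds z₀ (by positivity : 0 < r / 2)) (Filter.Eventually.of_forall hm) hint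
    hmeas (bound := fun x => bound x / (r / 3)) ?_ (hbi.div_const _)
    hderiv).2.differentiableAt.differentiableWithinAt
  filter_upwards [hd, hbound] with x hx hbx z hz
  refine Complex.norm_deriv_le_of_forall_mem_sphere_norm_le (by positivity) ?_ fun w hw => ?_
  · refine DifferentiableOn.diffContOnCl (hx.mono ?_)
    rw [closure_ball _ (by positivity)]
    exact (hcb z hz).trans hsub
  · exact hbx w (hsub₁ (hcb z hz (Metric.sphere_subset_closedBall hw)))

lemma measurable_firstProd {m : ℕ} (n : ℕ) : Measurable (firstProd (m := m) n) := by
  unfold firstProd; fun_prop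

lemma measurable_integrand {m : ℕ} (k l : ℕ) (α γ : ℂ) :
    Measurable (integrand (m := m) k l α γ) := by
  have h1 := measurable_firstProd (m := m)
  have h2 := measurable_vdm (m := m)
  unfold integrand
  fun_prop

lemma firstProd_eq {m : ℕ} (n : ℕ) (x : Fin m → ℝ) :
    firstProd n x = ∏ j : Fin m, if j.val < n then x j else 1 := by
  rw [firstProd, Finset.prod_filter]

/-- The rate `1 / 4` is chosen so that three uses (two initial products and the variation of `Re α`)
still leave `exp (-t / 4)` of the original exponential. -/
lemma one_add_le_mul_exp {t : ℝ} : 1 + t ≤ 4 * Real.exp (t / 4) := by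
  linarith [Real.add_one_le_exp (t / 4)]

lemma rpow_le_rpow_add_rpow {t a b c : ℝ} (ht : 0 < t) (hab : a ≤ b) (hbc : b ≤ c) :
    t ^ b ≤ t ^ a + t ^ c := by
  rcases le_or_gt 1 t with h | h
  · exact (Real.rpow_le_rpow_of_exponent_le h hbc).trans (by linarith [Real.rpow_pos_of_pos ht a])
  · exact (Real.rpow_le_rpow_of_exponent_ge ht h.le hab).trans
      (by linarith [Real.rpow_pos_of_pos ht c])

/-- A bound for the integrand that is uniform for parameters in a strip. -/
lemma norm_integrand_le {m : ℕ} (k l : ℕ) {α γ : ℂ} {a g₁ g₂ : ℝ} (ha : a ≤ α.re)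
    (ha' : α.re ≤ a + 1) (hg₁ : g₁ ≤ γ.re) (hg₂ : γ.re ≤ g₂) {x : Fin m → ℝ}
    (hx : x ∈ posOrthant m) (hinj : Function.Injective x) :
    ‖integrand k l α γ x‖ ≤ 4 ^ (3 * m) * (dens a g₁ (1 / 4) x + dens a g₂ (1 / 4) x) := by
  have hv := abs_vdm_pos hinj
  have hfirst : ∀ n, ‖(firstProd n x : ℂ)‖ ≤ ∏ j, (4 * Real.exp (x j / 4)) := by
    intro n
    rw [Complex.norm_real, Real.norm_eq_abs, firstProd_eq, Finset.abs_prod]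
    refine Finset.prod_le_prod (fun _ _ => abs_nonneg _) fun j _ => ?_
    have hj : 0 < x j := hx j
    have := one_add_le_mul_exp (t := x j)
    split_ifs
    · rw [abs_of_pos hj]; linarith
    · rw [abs_one]; linarith
  have hvdm : ‖((|vdm x| : ℝ) : ℂ) ^ (2 * γ)‖ ≤ |vdm x| ^ (2 * g₁) + |vdm x| ^ (2 * g₂) := by
    rw [Complex.norm_cpow_eq_rpow_re_of_pos hv]
    have : (2 * γ).re = 2 * γ.re := by simp
    rw [this]
    exact rpow_le_rpow_add_rpow hv (by linarith) (by linarith)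
  have hprod : ‖∏ j : Fin m, ((x j : ℂ) ^ (α - 1) * (Real.exp (-x j) : ℂ))‖ ≤
      ∏ j, (x j ^ (a - 1) * (4 * Real.exp (x j / 4)) * Real.exp (-x j)) := by
    rw [norm_prod]
    refine Finset.prod_le_prod (fun _ _ => norm_nonneg _) fun j _ => ?_
    have hj : 0 < x j := hx j
    rw [norm_mul, Complex.norm_cpow_eq_rpow_re_of_pos hj, Complex.norm_real, Real.norm_eq_abs,
      abs_of_pos (Real.exp_pos _)]
    have h1 : (α - 1).re = (a - 1) + (α.re - a) := by simp
    rw [h1, Real.rpow_add hj]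
    have h2 : x j ^ (α.re - a) ≤ 4 * Real.exp (x j / 4) :=
      calc x j ^ (α.re - a) ≤ (1 + x j) ^ (α.re - a) :=
            Real.rpow_le_rpow hj.le (by linarith) (by linarith)
        _ ≤ (1 + x j) ^ (1 : ℝ) := Real.rpow_le_rpow_of_exponent_le (by linarith) (by linarith)
        _ ≤ _ := by rw [Real.rpow_one]; exact one_add_le_mul_exp
    gcongr
  rw [integrand, norm_mul, norm_mul, norm_mul]
  have hE : 0 ≤ ∏ j, (4 * Real.exp (x j / 4)) := Finset.prod_nonneg fun j _ => by positivity
  calc _ ≤ (∏ j, (4 * Real.exp (x j / 4))) * (∏ j, (4 * Real.exp (x j / 4))) *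
        (|vdm x| ^ (2 * g₁) + |vdm x| ^ (2 * g₂)) *
        ∏ j, (x j ^ (a - 1) * (4 * Real.exp (x j / 4)) * Real.exp (-x j)) := by
        gcongr
        · exact hfirst k
        · exact hfirst l
    _ = (|vdm x| ^ (2 * g₁) + |vdm x| ^ (2 * g₂)) *
        ∏ j, (4 ^ 3 * (x j ^ (a - 1) * Real.exp (-(1 / 4) * x j))) := by
        rw [mul_right_comm, mul_comm, ← Finset.prod_mul_distrib, ← Finset.prod_mul_distrib]
        congr 1
        refine Finset.prod_congr rfl fun j _ => ?_
        have : Real.exp (-(1 / 4) * x j) = Real.exp (x j / 4) * Real.exp (x j / 4) *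
            (Real.exp (x j / 4) * Real.exp (-x j)) := by
          rw [← Real.exp_add, ← Real.exp_add, ← Real.exp_add]; congr 1; ring
        rw [this]; ring
    _ = _ := by
        rw [Finset.prod_mul_distrib, Finset.prod_const, Finset.card_univ, Fintype.card_fin, dens,
          dens, ← pow_mul]
        ring

/-- The domain of convergence of the exponential Selberg integral. -/
def ConvergenceDomain (m : ℕ) (a g : ℝ) : Prop :=
  0 < a ∧ -1 < m * g ∧ 0 < a + (m - 1) * g

lemma ConvergenceDomain.integrableOn_dens {m : ℕ} {a g c : ℝ} (h : ConvergenceDomain m a g)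
    (hc : 0 < c) : IntegrableOn (dens (m := m) a g c) (posOrthant m) :=
  SelbergExt.integrableOn_dens hc h.1 h.2.1 h.2.2

lemma ae_posOrthant_injective (m : ℕ) :
    ∀ᵐ x ∂(volume.restrict (posOrthant m)), x ∈ posOrthant m ∧ Function.Injective x := by
  filter_upwards [ae_restrict_mem (measurableSet_posOrthant m), ae_restrict_of_ae (ae_injective m)]
    with x hx hx' using ⟨hx, hx'⟩

theorem integrableOn_integrand {m : ℕ} (k l : ℕ) {α γ : ℂ}
    (h : ConvergenceDomain m α.re γ.re) :
    IntegrableOn (integrand (m := m) k l α γ) (posOrthant m) := by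
  have hb := (((h.integrableOn_dens (c := 1 / 4) (by norm_num)).add
    (h.integrableOn_dens (c := 1 / 4) (by norm_num))).const_mul (4 ^ (3 * m)))
  refine Integrable.mono' hb (measurable_integrand k l α γ).aestronglyMeasurable ?_
  filter_upwards [ae_posOrthant_injective m] with x hx
  exact norm_integrand_le k l le_rfl (by linarith) le_rfl le_rfl hx.1 hx.2

/-- The exponent `g - r` dominates where `|vdm x| ≤ 1`, and `g + r` where it is larger. With `r ≤ 1
/ 2`, the values of `Re α` near `a` stay within `1` of `a - r`, as `norm_integrand_le` requires. -/
lemma exists_pos_convergenceDomain {m : ℕ} {a g : ℝ} (h : ConvergenceDomain m a g) :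
    ∃ r : ℝ, 0 < r ∧ r ≤ 1 / 2 ∧ ConvergenceDomain m (a - r) (g - r) ∧
      ConvergenceDomain m (a - r) (g + r) := by
  obtain ⟨h1, h2, h3⟩ := h
  have key : ∀ s : ℝ, ∀ᶠ r : ℝ in nhdsWithin 0 (Ioi 0), ConvergenceDomain m (a - r) (g + s * r) := by
    intro s
    refine nhdsWithin_le_nhds ?_
    have e1 : ∀ᶠ r : ℝ in nhds 0, 0 < a - r :=
      ContinuousAt.eventually_lt continuousAt_const (by fun_prop) (by simpa using h1)
    have e2 : ∀ᶠ r : ℝ in nhds 0, -1 < (m : ℝ) * (g + s * r) :=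
      ContinuousAt.eventually_lt continuousAt_const (by fun_prop) (by simpa using h2)
    have e3 : ∀ᶠ r : ℝ in nhds 0, 0 < a - r + ((m : ℝ) - 1) * (g + s * r) :=
      ContinuousAt.eventually_lt continuousAt_const (by fun_prop) (by simpa using h3)
    filter_upwards [e1, e2, e3] with r h1 h2 h3 using ⟨h1, h2, h3⟩
  have e4 : ∀ᶠ r : ℝ in nhdsWithin 0 (Ioi 0), r ≤ 1 / 2 :=
    nhdsWithin_le_nhds (Iic_mem_nhds (by norm_num))
  obtain ⟨r, hr⟩ := ((key (-1)).and ((key 1).and (e4.and self_mem_nhdsWithin))).exists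
  refine ⟨r, hr.2.2.2, hr.2.2.1, ?_, ?_⟩
  · convert hr.1 using 1; ring
  · convert hr.2.1 using 1; ring

/-- Local domination of the integrand, uniform in both parameters. -/
lemma exists_local_bound {m : ℕ} (k l : ℕ) {α₀ γ₀ : ℂ} (h : ConvergenceDomain m α₀.re γ₀.re) :
    ∃ r > 0, ∃ bound : (Fin m → ℝ) → ℝ, Integrable bound (volume.restrict (posOrthant m)) ∧
      ∀ᵐ x ∂(volume.restrict (posOrthant m)), ∀ α ∈ Metric.ball α₀ r, ∀ γ ∈ Metric.ball γ₀ r,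
        ‖integrand k l α γ x‖ ≤ bound x := by
  obtain ⟨r, hr, hr2, h1, h2⟩ := exists_pos_convergenceDomain h
  refine ⟨r, hr, _, ((h1.integrableOn_dens (c := 1 / 4) (by norm_num)).add
    (h2.integrableOn_dens (c := 1 / 4) (by norm_num))).const_mul (4 ^ (3 * m)), ?_⟩
  have hre : ∀ {z w : ℂ}, z ∈ Metric.ball w r → |z.re - w.re| < r := fun {z w} hz => by
    rw [mem_ball_iff_norm] at hz
    exact (Complex.abs_re_le_norm (z - w)).trans_lt hz
  filter_upwards [ae_posOrthant_injective m] with x hx α hα γ hγ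
  have e1 := abs_lt.1 (hre hα)
  have e2 := abs_lt.1 (hre hγ)
  exact norm_integrand_le k l (by linarith) (by linarith) (by linarith) (by linarith) hx.1 hx.2

lemma differentiable_integrand_left {m : ℕ} (k l : ℕ) (γ : ℂ) {x : Fin m → ℝ}
    (hx : x ∈ posOrthant m) : Differentiable ℂ fun α => integrand k l α γ x := by
  unfold integrand
  refine Differentiable.const_mul ?_ _
  refine Differentiable.fun_finsetProd fun j _ => ?_
  refine Differentiable.mul_const ?_ _
  exact Differentiable.const_cpow (by fun_prop) (Or.inl (Complex.ofReal_ne_zero.2 (hx j).ne'))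

lemma differentiable_integrand_right {m : ℕ} (k l : ℕ) (α : ℂ) {x : Fin m → ℝ}
    (hx : Function.Injective x) : Differentiable ℂ fun γ => integrand k l α γ x := by
  unfold integrand
  refine Differentiable.mul_const (Differentiable.const_mul ?_ _) _
  exact Differentiable.const_cpow (by fun_prop)
    (Or.inl (Complex.ofReal_ne_zero.2 (abs_vdm_pos hx).ne'))

lemma isOpen_setOf_convergenceDomain {m : ℕ} {a g : ℂ → ℝ} (ha : Continuous a)
    (hg : Continuous g) : IsOpen {z : ℂ | ConvergenceDomain m (a z) (g z)} :=
  (isOpen_lt continuous_const ha).inter ((isOpen_lt continuous_const (continuous_const.mul hg)).inter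
    (isOpen_lt continuous_const (ha.add (continuous_const.mul hg))))

lemma differentiableOn_integral_left (m k l : ℕ) (γ : ℂ) :
    DifferentiableOn ℂ (fun α => ∫ x in posOrthant m, integrand k l α γ x)
      {α : ℂ | ConvergenceDomain m α.re γ.re} := by
  refine differentiableOn_integral_of_dominated (isOpen_setOf_convergenceDomain Complex.continuous_re continuous_const)
    (fun α => (measurable_integrand k l α γ).aestronglyMeasurable) ?_ fun α hα => ?_
  · filter_upwards [ae_posOrthant_injective m] with x hx
    exact (differentiable_integrand_left k l γ hx.1).differentiableOn
  · obtain ⟨r, hr, b, hb, h⟩ := exists_local_bound k l hα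
    exact ⟨r, hr, b, hb, h.mono fun x hx α hα => hx α hα γ (Metric.mem_ball_self hr)⟩

lemma differentiableOn_integral_right (m k l : ℕ) (α : ℂ) :
    DifferentiableOn ℂ (fun γ => ∫ x in posOrthant m, integrand k l α γ x)
      {γ : ℂ | ConvergenceDomain m α.re γ.re} := by
  refine differentiableOn_integral_of_dominated (isOpen_setOf_convergenceDomain continuous_const Complex.continuous_re)
    (fun γ => (measurable_integrand k l α γ).aestronglyMeasurable) ?_ fun γ hγ => ?_
  · filter_upwards [ae_posOrthant_injective m] with x hx
    exact (differentiable_integrand_right k l α hx.2).differentiableOn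
  · obtain ⟨r, hr, b, hb, h⟩ := exists_local_bound k l hγ
    exact ⟨r, hr, b, hb, h.mono fun x hx γ hγ => hx α (Metric.mem_ball_self hr) γ hγ⟩

/-! ### The closed form and analytic continuation. -/

/-- The value of the integral, with the rising factorials written without division by `γ`. -/
def closedForm (m k l : ℕ) (α γ : ℂ) : ℂ :=
  (∏ i ∈ Finset.range k, (1 + α + (2 * m - l - (i + 1)) * γ)) *
    (∏ i ∈ Finset.range l, (α + (m - (i + 1)) * γ)) * selbergValue m α γ

lemma integrand_ofReal {m : ℕ} (k l : ℕ) (a g : ℝ) {x : Fin m → ℝ} (hx : x ∈ posOrthant m) :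
    integrand k l (a : ℂ) (g : ℂ) x = (multiDens g (shape m a k l) x : ℂ) := by
  have h1 : multiDens g (shape m a k l) x = firstProd k x * firstProd l x * |vdm x| ^ (2 * g) *
      ∏ j, (x j ^ (a - 1) * Real.exp (-x j)) := by
    rw [multiDens, firstProd_eq, firstProd_eq, mul_comm, mul_right_comm, ← Finset.prod_mul_distrib,
      ← Finset.prod_mul_distrib]
    congr 1
    refine Finset.prod_congr rfl fun j _ => ?_
    have hj : 0 < x j := hx j
    rw [gammaWeight_of_pos _ _ hj, shape, Real.rpow_add hj, Real.rpow_add hj, neg_one_mul]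
    split_ifs <;> simp <;> ring
  rw [h1, integrand]
  push_cast
  rw [Complex.ofReal_cpow (abs_nonneg _)]
  push_cast
  congr 1
  refine Finset.prod_congr rfl fun j _ => ?_
  rw [Complex.ofReal_cpow (hx j).le]
  push_cast
  rfl

lemma multiDens_eq_zero_of_notMem {m : ℕ} (g : ℝ) (e : Fin m → ℝ) {x : Fin m → ℝ}
    (hx : x ∉ posOrthant m) : multiDens g e x = 0 := by
  obtain ⟨i, hi⟩ : ∃ i, x i ≤ 0 := by simpa [posOrthant] using hx
  rw [multiDens, Finset.prod_eq_zero (Finset.mem_univ i) (gammaWeight_of_nonpos _ _ hi), mul_zero]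

lemma integral_integrand_ofReal (m k l : ℕ) (a g : ℝ) :
    ∫ x in posOrthant m, integrand k l (a : ℂ) (g : ℂ) x =
      (multiInt g (shape m a k l) : ℂ) := by
  rw [setIntegral_congr_fun (measurableSet_posOrthant m) fun x hx => integrand_ofReal k l a g hx,
    integral_complex_ofReal, multiInt,
    setIntegral_eq_integral_of_forall_compl_eq_zero fun x hx => multiDens_eq_zero_of_notMem g _ hx]

lemma integral_integrand_of_large {m k l : ℕ} (hkl : k ≤ l) (hl : l ≤ m) {a g : ℝ} (ha : 1 < a)
    (hg : 1 / 2 < g) :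
    ∫ x in posOrthant m, integrand k l (a : ℂ) (g : ℂ) x = closedForm m k l a g := by
  rw [integral_integrand_ofReal, multiInt_shape hkl hl ha hg, multiInt_eq_prod_Gamma m hg ha,
    closedForm, selbergValue]
  push_cast
  simp only [← Complex.Gamma_ofReal]
  push_cast
  rfl

/-- Together with `ConvergenceDomain.add_mul_pos`, this keeps all Gamma arguments of the closed form
in the right half-plane. -/
lemma ConvergenceDomain.neg_one_lt_mul {m : ℕ} {a g : ℝ} (h : ConvergenceDomain m a g) {j : ℕ}
    (hj : j ≤ m) : -1 < j * g := by
  have hj' : (j : ℝ) ≤ m := by exact_mod_cast hj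
  have hj0 : (0 : ℝ) ≤ j := j.cast_nonneg
  rcases le_or_gt 0 g with h0 | h0
  · nlinarith
  · nlinarith [h.2.1]

lemma ConvergenceDomain.add_mul_pos {m : ℕ} {a g : ℝ} (h : ConvergenceDomain m a g) {j : ℕ}
    (hj : j < m) : 0 < a + j * g := by
  have hj' : (j : ℝ) + 1 ≤ m := by exact_mod_cast hj
  have hj0 : (0 : ℝ) ≤ j := j.cast_nonneg
  rcases le_or_gt 0 g with h0 | h0
  · have := h.1; positivity
  · nlinarith [h.2.2]

lemma differentiableAt_Gamma_of_re_pos {s : ℂ} (hs : 0 < s.re) :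
    DifferentiableAt ℂ Complex.Gamma s := by
  refine Complex.differentiableAt_Gamma s fun n h => ?_
  have := congrArg Complex.re h
  simp only [Complex.neg_re, Complex.natCast_re] at this
  have : (0 : ℝ) ≤ n := n.cast_nonneg
  linarith

lemma differentiableAt_closedForm {m : ℕ} (hm : 1 ≤ m) (k l : ℕ) {α γ : ℂ → ℂ}
    (hα : Differentiable ℂ α) (hγ : Differentiable ℂ γ) {z : ℂ}
    (h : ConvergenceDomain m (α z).re (γ z).re) :
    DifferentiableAt ℂ (fun z => closedForm m k l (α z) (γ z)) z := by
  have hΓ : ∀ f : ℂ → ℂ, Differentiable ℂ f → 0 < (f z).re →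
      DifferentiableAt ℂ (fun z => Complex.Gamma (f z)) z := fun f hf h0 =>
    (differentiableAt_Gamma_of_re_pos h0).comp z (hf z)
  unfold closedForm selbergValue
  refine DifferentiableAt.mul (by fun_prop) ?_
  refine DifferentiableAt.fun_finsetProd fun j hj => ?_
  have hj : j < m := Finset.mem_range.1 hj
  have h1 : 0 < (1 + γ z).re := by
    have := h.neg_one_lt_mul hm
    simp only [Complex.add_re, Complex.one_re]
    push_cast at this
    linarith
  refine DifferentiableAt.fun_div (DifferentiableAt.fun_mul ?_ ?_) ?_
    (Complex.Gamma_ne_zero_of_re_pos h1)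
  · refine hΓ _ (by fun_prop) ?_
    have := h.neg_one_lt_mul hj
    have h2 : (1 + γ z + j * γ z).re = 1 + (γ z).re + j * (γ z).re := by simp
    rw [h2]
    push_cast at this
    linarith
  · refine hΓ _ (by fun_prop) ?_
    simpa using h.add_mul_pos hj
  · exact hΓ _ (by fun_prop) h1

/-- Two holomorphic functions that agree on a real half-line agree on every connected open set
containing it. -/
lemma eqOn_of_eq_on_real_ray {f g : ℂ → ℂ} {U : Set ℂ} (hU : IsOpen U) (hc : IsPreconnected U)
    (hf : DifferentiableOn ℂ f U) (hg : DifferentiableOn ℂ g U) {c : ℝ}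
    (hmem : ∀ t : ℝ, c < t → (t : ℂ) ∈ U) (hfg : ∀ t : ℝ, c < t → f t = g t) : EqOn f g U := by
  refine (hf.analyticOnNhd hU).eqOn_of_preconnected_of_frequently_eq (hg.analyticOnNhd hU) hc
    (hmem (c + 1) (by linarith)) ?_
  have ht : Filter.Tendsto (fun t : ℝ => (t : ℂ)) (nhdsWithin (c + 1) {c + 1}ᶜ)
      (nhdsWithin ((c + 1 : ℝ) : ℂ) {((c + 1 : ℝ) : ℂ)}ᶜ) := by
    refine Complex.continuous_ofReal.continuousWithinAt.tendsto_nhdsWithin fun t ht => ?_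
    simpa only [mem_compl_iff, mem_singleton_iff, Complex.ofReal_inj] using ht
  refine ht.frequently (Filter.Eventually.frequently ?_)
  filter_upwards [nhdsWithin_le_nhds (Ioi_mem_nhds (by linarith : c < c + 1))] with t ht
    using hfg t ht

lemma convex_setOf_convergenceDomain (m : ℕ) (a : ℝ) :
    Convex ℝ {γ : ℂ | ConvergenceDomain m a γ.re} := by
  have hlin : ∀ c : ℝ, IsLinearMap ℝ fun z : ℂ => c * z.re := fun c =>
    ⟨fun x y => by simp [mul_add], fun s x => by simp; ring⟩
  have : {γ : ℂ | ConvergenceDomain m a γ.re} = {_γ : ℂ | 0 < a} ∩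
      ({γ : ℂ | -1 < (m : ℝ) * γ.re} ∩ {γ : ℂ | -a < ((m : ℝ) - 1) * γ.re}) := by
    ext γ
    simp only [ConvergenceDomain, mem_inter_iff, mem_ofPred_eq]
    refine and_congr_right fun _ => and_congr_right fun _ => ?_
    constructor <;> intro h <;> linarith
  rw [this]
  refine Convex.inter ?_ ((convex_halfSpace_gt (hlin _) _).inter (convex_halfSpace_gt (hlin _) _))
  intro x hx y hy s t hs ht hst
  exact hx

lemma convergenceDomain_of_nonneg {m : ℕ} (hm : 1 ≤ m) {a g : ℝ} (ha : 0 < a) (hg : 0 ≤ g) :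
    ConvergenceDomain m a g := by
  have : (1 : ℝ) ≤ m := by exact_mod_cast hm
  exact ⟨ha, by nlinarith, by nlinarith⟩

/-- The exponential Selberg integral with two overlapping products of initial coordinates. -/
theorem integral_integrand {m k l : ℕ} (hm : 1 ≤ m) (hkl : k ≤ l) (hl : l ≤ m) {α γ : ℂ}
    (h : ConvergenceDomain m α.re γ.re) :
    ∫ x in posOrthant m, integrand k l α γ x = closedForm m k l α γ := by
  -- Continuation is done one variable at a time: for fixed real `g > 1 / 2` in the half-plane `Re α
  -- > 0`, then for fixed `α` in the convex domain of `γ`, which contains the ray `(1/2, ∞)`.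
  have hreal : ∀ g : ℝ, 1 / 2 < g → ∀ α : ℂ, 0 < α.re →
      ∫ x in posOrthant m, integrand k l α (g : ℂ) x = closedForm m k l α g := by
    intro g hg α hα
    have hsub : ∀ α : ℂ, 0 < α.re → ConvergenceDomain m α.re (g : ℂ).re := fun α hα =>
      convergenceDomain_of_nonneg hm hα (by rw [Complex.ofReal_re]; linarith)
    exact eqOn_of_eq_on_real_ray (U := {α : ℂ | 0 < α.re}) (c := 1)
      (isOpen_lt continuous_const Complex.continuous_re)
      (convex_halfSpace_re_gt 0).isPreconnected
      ((differentiableOn_integral_left m k l g).mono hsub)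
      (fun α hα => (differentiableAt_closedForm hm k l (α := fun z => z) (γ := fun _ => (g : ℂ))
        differentiable_id (differentiable_const _) (hsub α hα)).differentiableWithinAt)
      (fun t ht => by simpa using zero_lt_one.trans ht)
      (fun t ht => integral_integrand_of_large hkl hl ht hg) hα
  refine eqOn_of_eq_on_real_ray (U := {γ : ℂ | ConvergenceDomain m α.re γ.re}) (c := 1 / 2)
    (f := fun γ => ∫ x in posOrthant m, integrand k l α γ x) (g := fun γ => closedForm m k l α γ)
    (isOpen_setOf_convergenceDomain continuous_const Complex.continuous_re)
    (convex_setOf_convergenceDomain m α.re).isPreconnected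
    (differentiableOn_integral_right m k l α)
    (fun γ hγ => (differentiableAt_closedForm hm k l (α := fun _ => α) (γ := fun z => z)
        (differentiable_const _) differentiable_id hγ).differentiableWithinAt)
    (fun t ht => convergenceDomain_of_nonneg hm h.1 (by rw [Complex.ofReal_re]; linarith))
    (fun t ht => hreal t ht α h.1) h

/-! ### Rewriting the closed form with rising factorials. -/

/-- One factor `γ` clears the denominator of each term; the order of the product is reversed. -/
lemma pow_mul_rising_eq {γ : ℂ} (hγ : γ ≠ 0) (b c : ℂ) (n : ℕ) :
    γ ^ n * rising (b / γ + c - n) n = ∏ i ∈ Finset.range n, (b + (c - (i + 1)) * γ) := by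
  rw [rising, ← Finset.prod_range_reflect, ← Finset.card_range n, ← Finset.prod_const,
    Finset.card_range, ← Finset.prod_mul_distrib]
  refine Finset.prod_congr rfl fun i hi => ?_
  have : i < n := Finset.mem_range.1 hi
  rw [Nat.sub_sub, Nat.cast_sub (by omega)]
  push_cast
  field_simp
  ring_nf

lemma closedForm_of_ne_zero (m k l : ℕ) (α : ℂ) {γ : ℂ} (hγ : γ ≠ 0) :
    closedForm m k l α γ = γ ^ (k + l) *
      rising ((1 + α) / γ + 2 * (m : ℂ) - (l : ℂ) - (k : ℂ)) k *
      rising (α / γ + (m : ℂ) - (l : ℂ)) l * selbergValue m α γ := by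
  rw [closedForm, ← pow_mul_rising_eq hγ, ← pow_mul_rising_eq hγ, pow_add,
    add_sub_assoc ((1 + α) / γ), add_sub_assoc (α / γ)]
  ring_nf

lemma closedForm_zero (m k l : ℕ) (α : ℂ) :
    closedForm m k l α 0 = (1 + α) ^ k * α ^ l * selbergValue m α 0 := by
  simp [closedForm]

lemma convergenceDomain_of_lt {m : ℕ} (hm : 1 ≤ m) {a g : ℝ} (ha : 0 < a)
    (hg : -(1 / (m : ℝ)) < g) (hg' : 2 ≤ m → -(a / ((m : ℝ) - 1)) < g) :
    ConvergenceDomain m a g := by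
  have hm0 : (0 : ℝ) < m := by exact_mod_cast hm
  refine ⟨ha, ?_, ?_⟩
  · rw [← neg_div, div_lt_iff₀ hm0] at hg
    linarith
  · rcases hm.eq_or_lt with h1 | h2
    · simpa [← h1] using ha
    · have h3 : (0 : ℝ) < (m : ℝ) - 1 := by
        have : (1 : ℝ) < m := by exact_mod_cast h2
        linarith
      have := hg' h2
      rw [← neg_div, div_lt_iff₀ h3] at this
      linarith

end SelbergExt

end

theorem lemma3p1 (m k l : ℕ) (hkl : k ≤ l) (hlm : l < m) (α γ : ℂ) (hα : 0 < α.re)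
    (hγ : -(1 / (m : ℝ)) < γ.re)
    (hγ' : 2 ≤ m → -(α.re / ((m : ℝ) - 1)) < γ.re) :
    MeasureTheory.IntegrableOn (SelbergExt.integrand (m := m) k l α γ)
        (SelbergExt.posOrthant m) MeasureTheory.volume ∧
    (γ ≠ 0 →
      ∫ x in SelbergExt.posOrthant m, SelbergExt.integrand k l α γ x =
        γ ^ (k + l) *
          SelbergExt.rising ((1 + α) / γ + 2 * (m : ℂ) - (l : ℂ) - (k : ℂ)) k *
          SelbergExt.rising (α / γ + (m : ℂ) - (l : ℂ)) l *
          SelbergExt.selbergValue m α γ) ∧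
    (γ = 0 →
      ∫ x in SelbergExt.posOrthant m, SelbergExt.integrand k l α γ x =
        (1 + α) ^ k * α ^ l * SelbergExt.selbergValue m α γ) := by
  have hm : 1 ≤ m := by omega
  have h := SelbergExt.convergenceDomain_of_lt hm hα hγ hγ'
  refine ⟨SelbergExt.integrableOn_integrand k l h, fun h0 => ?_, fun h0 => ?_⟩
  · rw [SelbergExt.integral_integrand hm hkl hlm.le h, SelbergExt.closedForm_of_ne_zero m k l α h0]
  · rw [SelbergExt.integral_integrand hm hkl hlm.le h, h0, SelbergExt.closedForm_zero]
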